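/- For every integer $d\ge 1$ and all $p\in(1,\infty)$, $\theta\in(0,1)$ with $\theta p\ge 1$ there is a constant $0<C_{p,\theta,d}<\infty$ such that the following holds. Let $q\ge 1$ be an integer and let $A_0,A_1,B$ be finite-dimensional complex Banach spaces such that $(A_0,A_1)$ is a compatible pair, i.e. both are continuously embedded in a common Hausdorff topological vector space and $A_0\cap A_1$ is dense both in $A_0$ and in $A_1$; let $A_0+A_1$ be their (finite-dimensional) sum. Let $m:\mathbb{R}^d\to L(B,A_0+A_1)$ be a bounded measurable function that vanishes outside $[-1/2,1/2]^d/q$, and let $T$ be the associated Fourier multiplier operator $$Tf(x)=\int_{\mathbb{R}^d} m(\xi)\,\widehat f(\xi)\,e^{2\pi i x\cdot\xi}\,d\xi,\qquad \widehat f(\xi)=\int_{\mathbb{R}^d} f(x)e^{-2\pi i x\cdot \xi}\,dx .$$ Put $m^q_{\mathrm{per}}(\xi)=\sum_{l\in\mathbb{Z}^d}m(\xi-l/q)$ and let $T^q_{\mathrm{dis}}$ be the associated Fourier multiplier operator on $\mathbb{Z}^d$, $$T^q_{\mathrm{dis}}f(n)=\int_{[-1/2,1/2]^d} m^q_{\mathrm{per}}(\xi)\,\widehat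 f(\xi)\,e^{2\pi i n\cdot\xi}\,d\xi,\qquad \widehat f(\xi)=\sum_{k\in\mathbb{Z}^d} f(k)e^{-2\pi i k\cdot \xi}.$$ Then $$\|T^q_{\mathrm{dis}}\|_{\ell^p(\mathbb{Z}^d;B)\to[\ell^\infty(\mathbb{Z}^d;A_0),\,\ell^{\theta p}(\mathbb{Z}^d;A_1)]_{\theta,\infty}}\le C_{p,\theta,d}\,\|T\|_{L^p(\mathbb{R}^d;B)\to[L^\infty(\mathbb{R}^d;A_0),\,L^{\theta p}(\mathbb{R}^d;A_1)]_{\theta,\infty}}.$$ Here, for a pair $(E_0,E_1)$ of compatible spaces, $[E_0,E_1]_{\theta,\infty}(a)=\sup_{j\in\mathbb{Z}}2^{-j\theta}K(2^j,a)$ with $K(t,a)=\inf_{a=a_0+a_1}(\|a_0\|_{E_0}+t\|a_1\|_{E_1})$, an infimum over the empty set being $\infty$. The operator norms take values in $[0,\infty]$ and are the best constants in the corresponding inequalities for $f$ in the dense subspaces $L^1\cap L^p$ of $L^p(\mathbb{R}^d;B)$ and $\ell^1\cap\ell^p=\ell^1$ of $\ell^p(\mathbb{Z}^d;B)$, on which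 $T$ and $T^q_{\mathrm{dis}}$ are given by the absolutely convergent formulas above. -/

import Mathlib

open MeasureTheory
open scoped ENNReal NNReal FourierTransform

noncomputable section

/-! ### Real interpolation (the `K`-method)

A (quasi-)normed space contained in an ambient additive group `V` is represented by its extended
norm `N : V → ℝ≥0∞`, which is `∞` outside of the space. -/

/-- Peetre's `K`-functional
`K(t, a; A₀, A₁) = inf {‖a₀‖_{A₀} + t ‖a₁‖_{A₁} : a = a₀ + a₁}`. -/
def peetreK {V : Type*} [Add V] (N₀ N₁ : V → ℝ≥0∞) (t : ℝ≥0∞) (a : V) : ℝ≥0∞ :=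
  ⨅ (a₀ : V) (a₁ : V) (_ : a₀ + a₁ = a), N₀ a₀ + t * N₁ a₁

/-- The norm of the real interpolation space `[A₀, A₁]_{θ,∞}`,
`sup_{j ∈ ℤ} 2^{-jθ} K(2^j, a; A₀, A₁)`. -/
def interpNormInfty {V : Type*} [Add V] (N₀ N₁ : V → ℝ≥0∞) (θ : ℝ) (a : V) : ℝ≥0∞ :=
  ⨆ j : ℤ, (2 : ℝ≥0∞) ^ (-(j : ℝ) * θ) * peetreK N₀ N₁ ((2 : ℝ≥0∞) ^ j) a

/-! ### Compatible pairs -/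

/-- `A₀` and `A₁` form a compatible pair with sum `A₀ + A₁ = S`: both are continuously embedded
in `S`, the intersection `A₀ ∩ A₁` is dense in `A₀` and in `A₁`, and `S` is the sum. -/
structure CompatiblePair (A₀ A₁ S : Type*)
    [NormedAddCommGroup A₀] [NormedSpace ℂ A₀] [NormedAddCommGroup A₁] [NormedSpace ℂ A₁]
    [NormedAddCommGroup S] [NormedSpace ℂ S] where
  /-- the inclusion of `A₀` -/
  ι₀ : A₀ →L[ℂ] S
  /-- the inclusion of `A₁` -/
  ι₁ : A₁ →L[ℂ] S
  injective₀ : Function.Injective ι₀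
  injective₁ : Function.Injective ι₁
  dense₀ : Dense {a : A₀ | ∃ b : A₁, ι₁ b = ι₀ a}
  dense₁ : Dense {b : A₁ | ∃ a : A₀, ι₀ a = ι₁ b}
  exists_add_eq : ∀ s : S, ∃ (a : A₀) (b : A₁), ι₀ a + ι₁ b = s

/-- The norm of the Bochner space `L^r(X; A)`, where `A` is embedded in `S` by `ι`, as an extended
norm on functions `X → S` (which only depends on the almost everywhere class of `h`): it is
`‖g‖_{L^r}` if `h = ι ∘ g` almost everywhere with `g ∈ L^r(X; A)`, and `∞` if there is no
such `g`. -/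
def bochnerNorm {X A S : Type*} [MeasurableSpace X] (μ : Measure X)
    [NormedAddCommGroup A] [NormedSpace ℂ A] [NormedAddCommGroup S] [NormedSpace ℂ S]
    (ι : A →L[ℂ] S) (r : ℝ≥0∞) (h : X → S) : ℝ≥0∞ :=
  ⨅ (g : X → A) (_ : MemLp g r μ) (_ : h =ᵐ[μ] fun x => ι (g x)), eLpNorm g r μ

/-- The norm of `[L^∞(X; A₀), L^r(X; A₁)]_{θ,∞}`. -/
def bochnerInterpNorm {X A₀ A₁ S : Type*} [MeasurableSpace X] (μ : Measure X)
    [NormedAddCommGroup A₀] [NormedSpace ℂ A₀] [NormedAddCommGroup A₁] [NormedSpace ℂ A₁]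
    [NormedAddCommGroup S] [NormedSpace ℂ S]
    (P : CompatiblePair A₀ A₁ S) (r : ℝ≥0∞) (θ : ℝ) (h : X → S) : ℝ≥0∞ :=
  interpNormInfty (bochnerNorm μ P.ι₀ ∞) (bochnerNorm μ P.ι₁ r) θ h

/-! ### Fourier multipliers on `ℝ^d` and on `ℤ^d` -/

/-- The cube `[-1/2, 1/2]^d / q`. -/
def cube (d q : ℕ) : Set (EuclideanSpace ℝ (Fin d)) := {ξ | ∀ i, |ξ i| ≤ 1 / 2 / (q : ℝ)}

/-- The pairing `n · ξ` of `n ∈ ℤ^d` and `ξ ∈ ℝ^d`. -/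
def latticePairing {d : ℕ} (n : Fin d → ℤ) (ξ : EuclideanSpace ℝ (Fin d)) : ℝ :=
  ∑ i, (n i : ℝ) * ξ i

section Multipliers

variable {d : ℕ} {B S : Type*} [NormedAddCommGroup B] [NormedSpace ℂ B]
  [NormedAddCommGroup S] [NormedSpace ℂ S]

/-- The Fourier multiplier operator over `ℝ^d` with multiplier `m`,
`T f = 𝓕⁻¹ (m · 𝓕 f)`, where `𝓕 f (ξ) = ∫ f(x) e^{-2πi x·ξ} dx`. It is used for `f ∈ L¹` and
bounded compactly supported `m`, so that all integrals converge absolutely. -/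
def contMultiplierOp (m : EuclideanSpace ℝ (Fin d) → (B →L[ℂ] S))
    (f : EuclideanSpace ℝ (Fin d) → B) : EuclideanSpace ℝ (Fin d) → S :=
  𝓕⁻ (fun ξ => m ξ (𝓕 f ξ))

/-- The periodization `m_per^q (ξ) = ∑_{l ∈ ℤ^d} m (ξ - l/q)`. -/
def periodization (q : ℕ) (m : EuclideanSpace ℝ (Fin d) → (B →L[ℂ] S))
    (ξ : EuclideanSpace ℝ (Fin d)) : B →L[ℂ] S :=
  ∑' l : Fin d → ℤ, m (ξ - WithLp.toLp 2 fun i => (l i : ℝ) / (q : ℝ))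

/-- The Fourier series `f̂(ξ) = ∑_{k ∈ ℤ^d} f(k) e^{-2πi k·ξ}` of a function on `ℤ^d`. -/
def latticeFourier (f : (Fin d → ℤ) → B) (ξ : EuclideanSpace ℝ (Fin d)) : B :=
  ∑' k : Fin d → ℤ, Complex.exp (-(2 * Real.pi * latticePairing k ξ : ℝ) * Complex.I) • f k

/-- The Fourier multiplier operator over `ℤ^d` with `ℤ^d`-periodic multiplier `M`,
`f ↦ (n ↦ ∫_{[-1/2,1/2]^d} M(ξ) f̂(ξ) e^{2πi n·ξ} dξ)`. -/
def latticeMultiplierOp (M : EuclideanSpace ℝ (Fin d) → (B →L[ℂ] S))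
    (f : (Fin d → ℤ) → B) (n : Fin d → ℤ) : S :=
  ∫ ξ in cube d 1,
    Complex.exp ((2 * Real.pi * latticePairing n ξ : ℝ) * Complex.I) • M ξ (latticeFourier f ξ)

/-- The norm of an operator `T` defined on functions `X → B` belonging to the dense subspace
`L¹ ∩ L^p` of `L^p(X; B)`, as an operator from `L^p(X; B)` to the space with extended norm `N`:
the least `C ∈ [0, ∞]` with `N (T f) ≤ C ‖f‖_{L^p}` for all `f ∈ L¹ ∩ L^p`. -/
def lpOpNorm {X G : Type*} [MeasurableSpace X] (μ : Measure X) (p : ℝ≥0∞) (N : G → ℝ≥0∞)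
    (T : (X → B) → G) : ℝ≥0∞ :=
  sInf {C : ℝ≥0∞ | ∀ f : X → B, MemLp f 1 μ → MemLp f p μ → N (T f) ≤ C * eLpNorm f p μ}

end Multipliers

end

noncomputable section

/-! ### The tiling of `ℝ^d` by unit cubes -/

/-! Suppose first that q = 1. A function f on ℤ^d is extended to F = ∑ f(k) ψ(· - k), where ψ is
Schwartz and its Fourier transform is 1 on the unit cube. As m lives in that cube, T F takes the
values of the discrete operator at the integers. A decomposition of T F in Bochner spaces holds only
almost everywhere and cannot be restricted to ℤ^d, so both pieces are convolved with ψ before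
sampling; this reproduces the band-limited T F. Synthesis and sampling are bounded by Schur's test,
because the translates of ψ are uniformly summable (`KBound.exists_decomposition`).

For general q, writing l = qk + s unfolds the periodization, and averaging over shifts by s/q shows
that the operator preserves residue classes modulo q and acts on each one as the q = 1 operator with
multiplier m(·/q) (`latticeMultiplierOp_periodization`). The estimate K(t, T F) ≤ N t^θ ‖F‖_p for
all t is dilation invariant (`KBound.dilate`), so all classes obey one bound, independent of q.

Adding up the q^d classes must not cost a power of q. Let a be the norm of f and b_s its norm on
class s. Class s is decomposed at level t (a / b_s)^{1/θ}. The L^∞ bounds then coincide, while the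
L^{θp} bounds are proportional to (b_s / a)^{1/θ}, whose θp-th powers sum to 1 because ∑ b_s^p = a^p
(`peetreK_le_of_residue`). The level may depend on s because the interpolation parameter ∞ controls
K at every t. -/

/-- The integer vector `n` as a point of `ℝ^d`. -/
def latticePoint {d : ℕ} (n : Fin d → ℤ) : EuclideanSpace ℝ (Fin d) :=
  WithLp.toLp 2 fun i => (n i : ℝ)

/-- The half-open unit cube `[-1/2, 1/2)^d`. -/
def halfOpenCube (d : ℕ) : Set (EuclideanSpace ℝ (Fin d)) :=
  {ξ | ∀ i, ξ i ∈ Set.Ico (-1 / 2 : ℝ) (1 / 2)}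

section Tiling

variable {d : ℕ}

lemma latticePoint_apply (n : Fin d → ℤ) (i : Fin d) : latticePoint n i = (n i : ℝ) := rfl

lemma latticePoint_add (n k : Fin d → ℤ) :
    latticePoint (n + k) = latticePoint n + latticePoint k := by
  ext i; simp [latticePoint_apply]

lemma latticePoint_neg (n : Fin d → ℤ) : latticePoint (-n) = -latticePoint n := by
  ext i; simp [latticePoint_apply]

lemma inner_latticePoint (n : Fin d → ℤ) (ξ : EuclideanSpace ℝ (Fin d)) :
    inner ℝ (latticePoint n) ξ = latticePairing n ξ := by
  simp [latticePairing, PiLp.inner_apply, latticePoint_apply, mul_comm]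

lemma halfOpenCube_eq_preimage : halfOpenCube d =
    WithLp.ofLp ⁻¹' (Set.univ.pi fun _ => Set.Ico (-1 / 2 : ℝ) (1 / 2)) := by
  ext ξ; simp [halfOpenCube]

lemma cube_one_eq_preimage : cube d 1 =
    WithLp.ofLp ⁻¹' (Set.Icc (fun _ => (-1 / 2 : ℝ)) (fun _ => (1 / 2 : ℝ))) := by
  ext ξ
  simp only [cube, Set.mem_ofPred_eq, Set.mem_preimage, Set.mem_Icc, Pi.le_def, abs_le,
    forall_and]
  norm_num

lemma measurableSet_halfOpenCube : MeasurableSet (halfOpenCube d) := by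
  rw [halfOpenCube_eq_preimage]
  exact (PiLp.volume_preserving_ofLp _).measurable
    (MeasurableSet.univ_pi fun _ => measurableSet_Ico)

lemma halfOpenCube_ae_eq_cube : halfOpenCube d =ᵐ[volume] cube d 1 := by
  rw [halfOpenCube_eq_preimage, cube_one_eq_preimage]
  exact (PiLp.volume_preserving_ofLp _).quasiMeasurePreserving.preimage_ae_eq
    Measure.univ_pi_Ico_ae_eq_Icc

lemma volume_halfOpenCube : volume (halfOpenCube d) = 1 := by
  rw [halfOpenCube_eq_preimage, (PiLp.volume_preserving_ofLp _).measure_preimage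
    (MeasurableSet.univ_pi fun _ => measurableSet_Ico).nullMeasurableSet, Real.volume_pi_Ico]
  norm_num

lemma norm_le_of_mem_halfOpenCube {ξ : EuclideanSpace ℝ (Fin d)} (hξ : ξ ∈ halfOpenCube d) :
    ‖ξ‖ ≤ √d := by
  rw [EuclideanSpace.norm_eq]
  apply Real.sqrt_le_sqrt
  calc ∑ i, ‖ξ i‖ ^ 2 ≤ ∑ _i : Fin d, (1 : ℝ) := by
        refine Finset.sum_le_sum fun i _ => ?_
        have := hξ i
        rw [Real.norm_eq_abs, sq_abs]
        nlinarith [this.1, this.2]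
    _ = d := by simp

lemma pairwise_disjoint_preimage_halfOpenCube :
    Pairwise (Function.onFun Disjoint fun l : Fin d → ℤ =>
      (fun x => x + latticePoint l) ⁻¹' halfOpenCube d) := by
  intro l l' hne
  rw [Function.onFun, Set.disjoint_left]
  intro x hx hx'
  apply hne
  ext i
  have h1 := hx i
  have h2 := hx' i
  simp only [PiLp.add_apply, latticePoint_apply, Set.mem_Ico] at h1 h2
  have h3 : (l i : ℝ) < l' i + 1 := by linarith [h1.1, h1.2, h2.1, h2.2]
  have h4 : (l' i : ℝ) < l i + 1 := by linarith [h1.1, h1.2, h2.1, h2.2]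
  have h3' : l i < l' i + 1 := by exact_mod_cast h3
  have h4' : l' i < l i + 1 := by exact_mod_cast h4
  omega

lemma iUnion_preimage_halfOpenCube :
    ⋃ l : Fin d → ℤ, (fun x => x + latticePoint l) ⁻¹' halfOpenCube d = Set.univ := by
  refine Set.eq_univ_of_forall fun x => Set.mem_iUnion.2 ⟨fun i => -⌊x i + 1 / 2⌋, fun i => ?_⟩
  simp only [PiLp.add_apply, latticePoint_apply, Set.mem_Ico, Int.cast_neg]
  have h1 := Int.floor_le (x i + 1 / 2)
  have h2 := Int.lt_floor_add_one (x i + 1 / 2)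
  constructor <;> linarith

lemma measurableSet_preimage_halfOpenCube (l : Fin d → ℤ) :
    MeasurableSet ((fun x => x + latticePoint l) ⁻¹' halfOpenCube d) :=
  measurable_add_const _ measurableSet_halfOpenCube

lemma lintegral_eq_tsum_halfOpenCube (w : EuclideanSpace ℝ (Fin d) → ℝ≥0∞) :
    ∫⁻ x, w x = ∑' l : Fin d → ℤ, ∫⁻ x in halfOpenCube d, w (x - latticePoint l) := by
  rw [← setLIntegral_univ, ← iUnion_preimage_halfOpenCube,
    lintegral_iUnion measurableSet_preimage_halfOpenCube pairwise_disjoint_preimage_halfOpenCube]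
  refine tsum_congr fun l => ?_
  simpa using (measurePreserving_add_right volume (latticePoint l)).setLIntegral_comp_preimage_emb
    (measurableEmbedding_addRight _) (fun x => w (x - latticePoint l)) (halfOpenCube d)

lemma hasSum_setIntegral_halfOpenCube {F : Type*} [NormedAddCommGroup F] [NormedSpace ℝ F]
    {w : EuclideanSpace ℝ (Fin d) → F} (hw : Integrable w) :
    HasSum (fun l : Fin d → ℤ => ∫ x in halfOpenCube d, w (x - latticePoint l)) (∫ x, w x) := by
  have h := hasSum_integral_iUnion (f := w) (μ := volume) measurableSet_preimage_halfOpenCube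
    (pairwise_disjoint_preimage_halfOpenCube (d := d)) hw.integrableOn
  rw [iUnion_preimage_halfOpenCube, setIntegral_univ] at h
  convert h using 2 with l
  simpa using ((measurePreserving_add_right volume (latticePoint l)).setIntegral_preimage_emb
    (measurableEmbedding_addRight _) (fun x => w (x - latticePoint l)) (halfOpenCube d)).symm

/-- The translates by `ℤ^d` of an integrable radially decreasing weight have a bounded sum. -/
lemma exists_tsum_one_add_norm_le (d : ℕ) : ∃ M : ℝ≥0∞, M ≠ ∞ ∧
    ∀ x : EuclideanSpace ℝ (Fin d),
      ∑' k : Fin d → ℤ, ENNReal.ofReal ((1 + ‖x - latticePoint k‖) ^ (-((d : ℝ) + 1))) ≤ M := by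
  set W : EuclideanSpace ℝ (Fin d) → ℝ≥0∞ :=
    fun y => ENNReal.ofReal ((1 + ‖y‖) ^ (-((d : ℝ) + 1))) with hW
  have hWfin : ∫⁻ y, W y < ∞ := finite_integral_one_add_norm (by simp)
  set K : ℝ≥0∞ := ENNReal.ofReal ((1 + √d) ^ ((d : ℝ) + 1)) with hK
  -- The weight varies by at most a constant factor over a unit cube, so each value is dominated by
  -- an average and the sum over translates by the full integral.
  have hcmp : ∀ a y : EuclideanSpace ℝ (Fin d), y ∈ halfOpenCube d → W a ≤ K * W (a + y) := by
    intro a y hy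
    rw [hW, hK, ← ENNReal.ofReal_mul (by positivity)]
    refine ENNReal.ofReal_le_ofReal ?_
    rw [Real.rpow_neg (by positivity), Real.rpow_neg (by positivity), ← div_eq_mul_inv,
      inv_eq_one_div, div_le_div_iff₀ (by positivity) (by positivity), one_mul,
      ← Real.mul_rpow (by positivity) (by positivity)]
    refine Real.rpow_le_rpow (by positivity) ?_ (by positivity)
    have h1 := norm_add_le a y
    have h2 := norm_le_of_mem_halfOpenCube hy
    nlinarith [norm_nonneg a, Real.sqrt_nonneg (d : ℝ)]
  refine ⟨K * ∫⁻ y, W y, ENNReal.mul_ne_top ENNReal.ofReal_ne_top hWfin.ne, fun x => ?_⟩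
  calc ∑' k : Fin d → ℤ, W (x - latticePoint k)
      ≤ ∑' k : Fin d → ℤ, K * ∫⁻ y in halfOpenCube d, W (x + (y - latticePoint k)) := by
        refine ENNReal.tsum_le_tsum fun k => ?_
        rw [← lintegral_const_mul' _ _ ENNReal.ofReal_ne_top]
        calc W (x - latticePoint k) = ∫⁻ _y in halfOpenCube d, W (x - latticePoint k) := by
              simp [volume_halfOpenCube]
          _ ≤ _ := by
              refine setLIntegral_mono' measurableSet_halfOpenCube fun y hy => ?_
              have := hcmp (x - latticePoint k) y hy
              rwa [show x - latticePoint k + y = x + (y - latticePoint k) by abel] at this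
    _ = K * ∫⁻ y, W (x + y) := by
        rw [ENNReal.tsum_mul_left, lintegral_eq_tsum_halfOpenCube]
    _ = K * ∫⁻ y, W y := by rw [lintegral_add_left_eq_self]

/-- A Schwartz function lies in the amalgam space `W(L^∞, ℓ^1)`. -/
lemma SchwartzMap.exists_tsum_enorm_le (ψ : SchwartzMap (EuclideanSpace ℝ (Fin d)) ℂ) :
    ∃ M : ℝ≥0, (∀ x, ∑' k : Fin d → ℤ, ‖ψ (x - latticePoint k)‖ₑ ≤ M) ∧
      (∀ x, ∑' k : Fin d → ℤ, ‖ψ (latticePoint k - x)‖ₑ ≤ M) ∧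
      ∫⁻ x, ‖ψ x‖ₑ ≤ M ∧ ∀ x, ‖ψ x‖ₑ ≤ M := by
  obtain ⟨M, hM, hMle⟩ := exists_tsum_one_add_norm_le d
  -- Decay of order d + 1 suffices: it is integrable on ℝ^d.
  obtain ⟨C, hC⟩ : ∃ C : ℝ, ∀ x, ‖ψ x‖ ≤ C * (1 + ‖x‖) ^ (-((d : ℝ) + 1)) := by
    refine ⟨2 ^ (d + 1) * ((Finset.Iic (d + 1, 0)).sup
      fun m => SchwartzMap.seminorm ℂ m.1 m.2) ψ, fun x => ?_⟩
    have h := ψ.one_add_le_sup_seminorm_apply (𝕜 := ℂ) (m := (d + 1, 0)) (k := d + 1) (n := 0)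
      le_rfl le_rfl x
    rw [norm_iteratedFDeriv_zero] at h
    rw [Real.rpow_neg (by positivity), ← div_eq_mul_inv, le_div_iff₀ (by positivity), mul_comm]
    exact_mod_cast h
  have hC' : ∀ x, ‖ψ x‖ₑ ≤
      ENNReal.ofReal C * ENNReal.ofReal ((1 + ‖x‖) ^ (-((d : ℝ) + 1))) := fun x => by
    rw [← ENNReal.ofReal_mul' (by positivity), ← ofReal_norm]
    exact ENNReal.ofReal_le_ofReal (hC x)
  have hsum : ∀ x, ∑' k : Fin d → ℤ, ‖ψ (x - latticePoint k)‖ₑ ≤ ENNReal.ofReal C * M := by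
    intro x
    refine (ENNReal.tsum_le_tsum fun k => hC' _).trans ?_
    rw [ENNReal.tsum_mul_left]
    gcongr
    exact hMle x
  have hsum' : ∀ x, ∑' k : Fin d → ℤ, ‖ψ (latticePoint k - x)‖ₑ ≤ ENNReal.ofReal C * M := by
    intro x
    refine (ENNReal.tsum_le_tsum fun k => hC' _).trans ?_
    rw [ENNReal.tsum_mul_left]
    gcongr
    simpa only [norm_sub_rev] using hMle x
  have hone : ∀ x, ‖ψ x‖ₑ ≤ ENNReal.ofReal C * M := by
    intro x
    refine le_trans ?_ (hsum x)
    have := ENNReal.le_tsum (f := fun k : Fin d → ℤ => ‖ψ (x - latticePoint k)‖ₑ) 0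
    rwa [show latticePoint (0 : Fin d → ℤ) = 0 by ext; simp [latticePoint_apply], sub_zero] at this
  have hint : ∫⁻ x, ‖ψ x‖ₑ ≤ ENNReal.ofReal C * M := by
    rw [lintegral_eq_tsum_halfOpenCube,
      ← lintegral_tsum fun k => by fun_prop]
    calc _ ≤ ∫⁻ _x in halfOpenCube d, ENNReal.ofReal C * M := lintegral_mono fun x => hsum x
      _ = _ := by simp [volume_halfOpenCube]
  lift ENNReal.ofReal C * M to ℝ≥0 using ENNReal.mul_ne_top ENNReal.ofReal_ne_top hM with M'
  exact ⟨M', hsum, hsum', hint, hone⟩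

end Tiling

/-! ### Schur's test -/

/-- Schur's test for a nonnegative kernel with bounded marginals. -/
lemma lintegral_rpow_lintegral_mul_le {X Y : Type*} [MeasurableSpace X] [MeasurableSpace Y]
    {μ : Measure X} {ν : Measure Y} [SFinite μ] [SFinite ν] {k : X → Y → ℝ≥0∞}
    (hk : Measurable (Function.uncurry k)) {M : ℝ≥0∞} (hM : M ≠ ∞)
    (hX : ∀ x, ∫⁻ y, k x y ∂ν ≤ M) (hY : ∀ y, ∫⁻ x, k x y ∂μ ≤ M)
    {g : Y → ℝ≥0∞} (hg : AEMeasurable g ν) {p : ℝ} (hp : 1 ≤ p) :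
    ∫⁻ x, (∫⁻ y, k x y * g y ∂ν) ^ p ∂μ ≤ M ^ p * ∫⁻ y, g y ^ p ∂ν := by
  wlog hgm : Measurable g generalizing g
  · have h := this (g := hg.mk g) hg.measurable_mk.aemeasurable hg.measurable_mk
    have e1 : ∀ x, ∫⁻ y, k x y * g y ∂ν = ∫⁻ y, k x y * hg.mk g y ∂ν := fun x =>
      lintegral_congr_ae (hg.ae_eq_mk.mono fun y hy => by simp only [hy])
    have e2 : ∫⁻ y, g y ^ p ∂ν = ∫⁻ y, hg.mk g y ^ p ∂ν :=
      lintegral_congr_ae (hg.ae_eq_mk.mono fun y hy => by simp only [hy])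
    simpa only [e1, e2] using h
  have hp0 : 0 < p := by linarith
  have hkx : ∀ x, Measurable (k x) := fun x => hk.comp measurable_prodMk_left
  have key : ∀ x, (∫⁻ y, k x y * g y ∂ν) ^ p ≤ M ^ (p - 1) * ∫⁻ y, k x y * g y ^ p ∂ν := by
    intro x
    -- Hölder for the measure k(x, ·) dν, whose total mass is at most M.
    have h := eLpNorm'_le_eLpNorm'_mul_rpow_measure_univ (μ := ν.withDensity (k x)) (f := g)
      one_pos hp hgm.aestronglyMeasurable
    simp only [eLpNorm', enorm_eq_self, ENNReal.rpow_one, div_one, withDensity_apply _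
      MeasurableSet.univ, Measure.restrict_univ] at h
    rw [lintegral_withDensity_eq_lintegral_mul _ (hkx x) hgm,
      lintegral_withDensity_eq_lintegral_mul _ (hkx x) (hgm.pow_const p)] at h
    simp only [Pi.mul_apply] at h
    calc _ ≤ _ := ENNReal.rpow_le_rpow h hp0.le
      _ = (∫⁻ y, k x y * g y ^ p ∂ν) * (∫⁻ y, k x y ∂ν) ^ (p - 1) := by
        rw [ENNReal.mul_rpow_of_nonneg _ _ hp0.le, ← ENNReal.rpow_mul, ← ENNReal.rpow_mul,
          one_div_mul_cancel hp0.ne', ENNReal.rpow_one]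
        congr 2
        field_simp
      _ ≤ _ := by
        rw [mul_comm]
        gcongr
        exact hX x
  calc ∫⁻ x, (∫⁻ y, k x y * g y ∂ν) ^ p ∂μ
      ≤ ∫⁻ x, M ^ (p - 1) * ∫⁻ y, k x y * g y ^ p ∂ν ∂μ := lintegral_mono key
    _ = M ^ (p - 1) * ∫⁻ x, ∫⁻ y, k x y * g y ^ p ∂ν ∂μ :=
        lintegral_const_mul' _ _ (ENNReal.rpow_ne_top_of_nonneg (by linarith) hM)
    _ = M ^ (p - 1) * ∫⁻ y, (∫⁻ x, k x y ∂μ) * g y ^ p ∂ν := by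
        rw [lintegral_lintegral_swap (by
          exact (hk.mul ((hgm.pow_const p).comp measurable_snd)).aemeasurable)]
        congr 1
        refine lintegral_congr fun y => ?_
        rw [lintegral_mul_const _ (show Measurable fun x => k x y from hk.comp measurable_prodMk_right)]
    _ ≤ M ^ (p - 1) * ∫⁻ y, M * g y ^ p ∂ν := by
        gcongr with y
        exact hY y
    _ = M ^ p * ∫⁻ y, g y ^ p ∂ν := by
        rw [lintegral_const_mul' _ _ hM, ← mul_assoc]
        congr 1
        conv_lhs => rw [← ENNReal.rpow_one M, ← ENNReal.rpow_mul, one_mul]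
        rw [← ENNReal.rpow_add_of_nonneg _ _ (by linarith) zero_le_one]
        congr 1; ring

/-- Two different measure spaces are allowed so that one statement serves both synthesis (ℤ^d to
ℝ^d) and sampling (ℝ^d to ℤ^d). -/
lemma eLpNorm_le_of_enorm_le_lintegral_mul {X Y E F : Type*} [MeasurableSpace X]
    [MeasurableSpace Y] [NormedAddCommGroup E] [NormedAddCommGroup F]
    {μ : Measure X} {ν : Measure Y} [SFinite μ] [SFinite ν] {k : X → Y → ℝ≥0∞}
    (hk : Measurable (Function.uncurry k)) {M : ℝ≥0∞} (hM : M ≠ ∞)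
    (hX : ∀ x, ∫⁻ y, k x y ∂ν ≤ M) (hY : ∀ y, ∫⁻ x, k x y ∂μ ≤ M)
    {g : Y → E} (hg : AEStronglyMeasurable g ν) {h : X → F}
    (hle : ∀ x, ‖h x‖ₑ ≤ ∫⁻ y, k x y * ‖g y‖ₑ ∂ν) {p : ℝ} (hp : 1 ≤ p) :
    eLpNorm h (ENNReal.ofReal p) μ ≤ M * eLpNorm g (ENNReal.ofReal p) ν := by
  have hp0 : 0 < p := by linarith
  rw [eLpNorm_eq_lintegral_rpow_enorm_toReal (by simpa using hp0) ENNReal.ofReal_ne_top,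
    eLpNorm_eq_lintegral_rpow_enorm_toReal (by simpa using hp0) ENNReal.ofReal_ne_top,
    ENNReal.toReal_ofReal hp0.le]
  calc (∫⁻ x, ‖h x‖ₑ ^ p ∂μ) ^ (1 / p) ≤ (M ^ p * ∫⁻ y, ‖g y‖ₑ ^ p ∂ν) ^ (1 / p) := by
        gcongr
        refine le_trans (lintegral_mono fun x => ?_)
          (lintegral_rpow_lintegral_mul_le hk hM hX hY hg.enorm hp)
        exact ENNReal.rpow_le_rpow (hle x) hp0.le
    _ = _ := by
        rw [ENNReal.mul_rpow_of_nonneg _ _ (by positivity), ← ENNReal.rpow_mul,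
          mul_one_div_cancel hp0.ne', ENNReal.rpow_one]

/-! ### Sampling and interpolation of functions on `ℤ^d` -/

/-- The function `x ↦ ∑_k f(k) ψ(x - k)` on `ℝ^d` interpolating `f : ℤ^d → B`. -/
def latticeSynthesis {d : ℕ} {B : Type*} [NormedAddCommGroup B] [NormedSpace ℂ B]
    (ψ : EuclideanSpace ℝ (Fin d) → ℂ) (f : (Fin d → ℤ) → B) (x : EuclideanSpace ℝ (Fin d)) : B :=
  ∑' k, ψ (x - latticePoint k) • f k

/-- The values on `ℤ^d` of the convolution `ψ * g`. -/
def latticeSample {d : ℕ} {A : Type*} [NormedAddCommGroup A] [NormedSpace ℂ A]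
    (ψ : EuclideanSpace ℝ (Fin d) → ℂ) (g : EuclideanSpace ℝ (Fin d) → A) (n : Fin d → ℤ) : A :=
  ∫ y, ψ (latticePoint n - y) • g y

/-- The character `ξ ↦ e^{2πi n·ξ}`. -/
def latticeChar {d : ℕ} (n : Fin d → ℤ) (ξ : EuclideanSpace ℝ (Fin d)) : ℂ :=
  Complex.exp ((2 * Real.pi * latticePairing n ξ : ℝ) * Complex.I)

/-- The operator `f ↦ (n ↦ ∫_{ℝ^d} m(ξ) f̂(ξ) e^{2πi n·ξ} dξ)`. -/
def unfoldedMultiplierOp {d : ℕ} {B S : Type*} [NormedAddCommGroup B] [NormedSpace ℂ B]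
    [NormedAddCommGroup S] [NormedSpace ℂ S] (m : EuclideanSpace ℝ (Fin d) → (B →L[ℂ] S))
    (f : (Fin d → ℤ) → B) (n : Fin d → ℤ) : S :=
  ∫ ξ, latticeChar n ξ • m ξ (latticeFourier f ξ)

/-- A Schwartz function whose Fourier transform is `1` on the unit cube, with a bound `M` for its
amalgam norm. -/
structure IsSamplingKernel {d : ℕ} (ψ : SchwartzMap (EuclideanSpace ℝ (Fin d)) ℂ) (M : ℝ≥0) :
    Prop where
  tsum_sub_le : ∀ x, ∑' k : Fin d → ℤ, ‖ψ (x - latticePoint k)‖ₑ ≤ M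
  tsum_sub_le' : ∀ x, ∑' k : Fin d → ℤ, ‖ψ (latticePoint k - x)‖ₑ ≤ M
  lintegral_le : ∫⁻ x, ‖ψ x‖ₑ ≤ M
  enorm_le : ∀ x, ‖ψ x‖ₑ ≤ M
  fourier_eq_one : ∀ ξ ∈ cube d 1, 𝓕 (ψ : EuclideanSpace ℝ (Fin d) → ℂ) ξ = 1

section Kernel

variable {d : ℕ} {A B S : Type*} [NormedAddCommGroup A] [NormedSpace ℂ A]
  [NormedAddCommGroup B] [NormedSpace ℂ B] [NormedAddCommGroup S] [NormedSpace ℂ S]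

lemma norm_le_of_mem_cube_one {ξ : EuclideanSpace ℝ (Fin d)} (hξ : ξ ∈ cube d 1) :
    ‖ξ‖ ≤ √d := by
  rw [EuclideanSpace.norm_eq]
  apply Real.sqrt_le_sqrt
  calc ∑ i, ‖ξ i‖ ^ 2 ≤ ∑ _i : Fin d, (1 : ℝ) := by
        refine Finset.sum_le_sum fun i _ => ?_
        have := hξ i
        rw [Real.norm_eq_abs]
        norm_num at this
        nlinarith [abs_nonneg (ξ i)]
    _ = d := by simp

/-- Take the inverse Fourier transform of a smooth bump that is 1 on a ball containing the cube,
which has circumradius at most √d. -/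
lemma exists_isSamplingKernel (d : ℕ) :
    ∃ (ψ : SchwartzMap (EuclideanSpace ℝ (Fin d)) ℂ) (M : ℝ≥0), IsSamplingKernel ψ M := by
  let χ : ContDiffBump (0 : EuclideanSpace ℝ (Fin d)) :=
    ⟨√d + 1, √d + 2, by positivity, by linarith⟩
  have h1 : HasCompactSupport (fun ξ => (χ ξ : ℂ)) :=
    χ.hasCompactSupport.comp_left (g := fun x : ℝ => (x : ℂ)) Complex.ofReal_zero
  have h2 : ContDiff ℝ (⊤ : ℕ∞) (fun ξ => (χ ξ : ℂ)) := Complex.ofRealCLM.contDiff.comp χ.contDiff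
  let Χ := h1.toSchwartzMap h2
  obtain ⟨M, hM1, hM2, hM3, hM4⟩ := SchwartzMap.exists_tsum_enorm_le (𝓕⁻ Χ)
  refine ⟨𝓕⁻ Χ, M, hM1, hM2, hM3, hM4, fun ξ hξ => ?_⟩
  rw [← SchwartzMap.fourier_coe, FourierTransform.fourier_fourierInv_eq]
  change (χ ξ : ℂ) = 1
  rw [χ.one_of_mem_closedBall, Complex.ofReal_one]
  simpa using (norm_le_of_mem_cube_one hξ).trans (by linarith : √(d : ℝ) ≤ √d + 1)

/-! ### Characters and Fourier series of ℤ^d. -/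

variable {ψ : SchwartzMap (EuclideanSpace ℝ (Fin d)) ℂ} {M : ℝ≥0}

lemma latticeChar_eq_fourierChar (n : Fin d → ℤ) (ξ : EuclideanSpace ℝ (Fin d)) :
    latticeChar n ξ = (Real.fourierChar (inner ℝ ξ (latticePoint n)) : ℂ) := by
  rw [real_inner_comm, inner_latticePoint, Real.fourierChar_apply, latticeChar]

lemma norm_latticeChar (n : Fin d → ℤ) (ξ : EuclideanSpace ℝ (Fin d)) :
    ‖latticeChar n ξ‖ = 1 := Complex.norm_exp_ofReal_mul_I _

lemma continuous_latticePairing (n : Fin d → ℤ) : Continuous (latticePairing n) := by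
  unfold latticePairing; fun_prop

lemma continuous_latticeChar (n : Fin d → ℤ) : Continuous (latticeChar n) := by
  have := continuous_latticePairing n
  unfold latticeChar; fun_prop

lemma latticePairing_add (n k : Fin d → ℤ) (ξ : EuclideanSpace ℝ (Fin d)) :
    latticePairing (n + k) ξ = latticePairing n ξ + latticePairing k ξ := by
  simp only [← inner_latticePoint, latticePoint_add, inner_add_left]

lemma latticePairing_neg (n : Fin d → ℤ) (ξ : EuclideanSpace ℝ (Fin d)) :
    latticePairing (-n) ξ = -latticePairing n ξ := by
  simp only [← inner_latticePoint, latticePoint_neg, inner_neg_left]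

lemma latticePairing_add_right (n : Fin d → ℤ) (ξ η : EuclideanSpace ℝ (Fin d)) :
    latticePairing n (ξ + η) = latticePairing n ξ + latticePairing n η := by
  simp only [← inner_latticePoint, inner_add_right]

lemma latticePairing_smul_right (n : Fin d → ℤ) (c : ℝ) (ξ : EuclideanSpace ℝ (Fin d)) :
    latticePairing n (c • ξ) = c * latticePairing n ξ := by
  simp only [← inner_latticePoint, inner_smul_right]

lemma latticeChar_add (n k : Fin d → ℤ) (ξ : EuclideanSpace ℝ (Fin d)) :
    latticeChar (n + k) ξ = latticeChar n ξ * latticeChar k ξ := by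
  simp only [latticeChar, latticePairing_add, ← Complex.exp_add]
  congr 1; push_cast; ring

lemma latticeChar_add_right (n : Fin d → ℤ) (ξ η : EuclideanSpace ℝ (Fin d)) :
    latticeChar n (ξ + η) = latticeChar n ξ * latticeChar n η := by
  simp only [latticeChar, latticePairing_add_right, ← Complex.exp_add]
  congr 1; push_cast; ring

lemma latticeFourier_eq (f : (Fin d → ℤ) → B) (ξ : EuclideanSpace ℝ (Fin d)) :
    latticeFourier f ξ = ∑' k, latticeChar (-k) ξ • f k := by
  simp only [latticeFourier, latticeChar, latticePairing_neg]
  refine tsum_congr fun k => ?_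
  congr 3; push_cast; ring

lemma summable_latticeFourier [CompleteSpace B] {f : (Fin d → ℤ) → B}
    (hf : Summable fun k => ‖f k‖) (ξ : EuclideanSpace ℝ (Fin d)) :
    Summable fun k => latticeChar (-k) ξ • f k :=
  Summable.of_norm (by simpa only [norm_smul, norm_latticeChar, one_mul] using hf)

lemma continuous_latticeFourier [CompleteSpace B] {f : (Fin d → ℤ) → B}
    (hf : Summable fun k => ‖f k‖) : Continuous (latticeFourier f) := by
  rw [funext (latticeFourier_eq f)]
  refine continuous_tsum (fun k => (continuous_latticeChar _).smul continuous_const) hf ?_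
  intro k x
  rw [norm_smul, norm_latticeChar, one_mul]

lemma norm_latticeFourier_le {f : (Fin d → ℤ) → B}
    (hf : Summable fun k => ‖f k‖) (ξ : EuclideanSpace ℝ (Fin d)) :
    ‖latticeFourier f ξ‖ ≤ ∑' k, ‖f k‖ := by
  rw [latticeFourier_eq]
  have h : (fun k => ‖latticeChar (-k) ξ • f k‖) = fun k => ‖f k‖ := by
    ext k; rw [norm_smul, norm_latticeChar, one_mul]
  rw [← h] at hf ⊢
  exact norm_tsum_le_tsum_norm hf

/-! ### Bounds and Fourier identities for synthesis and sampling. -/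

namespace IsSamplingKernel

lemma measurable_kernel (ψ : SchwartzMap (EuclideanSpace ℝ (Fin d)) ℂ) :
    Measurable (Function.uncurry fun (x : EuclideanSpace ℝ (Fin d)) (k : Fin d → ℤ) =>
      ‖ψ (x - latticePoint k)‖ₑ) :=
  measurable_from_prod_countable_left fun k => by
    exact (ψ.continuous.comp (continuous_sub_right (latticePoint k))).enorm.measurable

lemma measurable_kernel' (ψ : SchwartzMap (EuclideanSpace ℝ (Fin d)) ℂ) :
    Measurable (Function.uncurry fun (k : Fin d → ℤ) (x : EuclideanSpace ℝ (Fin d)) =>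
      ‖ψ (latticePoint k - x)‖ₑ) :=
  measurable_from_prod_countable_right fun k => by
    exact (ψ.continuous.comp (continuous_sub_left (latticePoint k))).enorm.measurable

lemma lintegral_sub_left_le (hψ : IsSamplingKernel ψ M) (a : EuclideanSpace ℝ (Fin d)) :
    ∫⁻ x, ‖ψ (a - x)‖ₑ ≤ M := by
  rw [lintegral_sub_left_eq_self (fun x => ‖ψ x‖ₑ) a]
  exact hψ.lintegral_le

lemma lintegral_sub_right_le (hψ : IsSamplingKernel ψ M) (a : EuclideanSpace ℝ (Fin d)) :
    ∫⁻ x, ‖ψ (x - a)‖ₑ ≤ M := by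
  rw [lintegral_sub_right_eq_self (fun x => ‖ψ x‖ₑ) a]
  exact hψ.lintegral_le

lemma norm_le (hψ : IsSamplingKernel ψ M) (x : EuclideanSpace ℝ (Fin d)) : ‖ψ x‖ ≤ M := by
  have := hψ.enorm_le x
  rw [enorm_eq_nnnorm] at this
  exact_mod_cast this

lemma continuous_latticeSynthesis [CompleteSpace B] (hψ : IsSamplingKernel ψ M)
    {f : (Fin d → ℤ) → B} (hf : Summable fun k => ‖f k‖) :
    Continuous (latticeSynthesis ψ f) := by
  refine continuous_tsum (u := fun k => M * ‖f k‖) (fun k => by fun_prop) (hf.mul_left _) ?_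
  intro k x
  rw [norm_smul]
  gcongr
  exact hψ.norm_le _

lemma eLpNorm_latticeSynthesis_le (hψ : IsSamplingKernel ψ M) (f : (Fin d → ℤ) → B)
    {p : ℝ} (hp : 1 ≤ p) :
    eLpNorm (latticeSynthesis ψ f) (ENNReal.ofReal p) volume ≤
      M * eLpNorm f (ENNReal.ofReal p) Measure.count := by
  refine eLpNorm_le_of_enorm_le_lintegral_mul (measurable_kernel ψ) ENNReal.coe_ne_top
    (fun x => by simpa only [lintegral_count] using hψ.tsum_sub_le x)
    (fun k => hψ.lintegral_sub_right_le _) (StronglyMeasurable.of_discrete).aestronglyMeasurable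
    (fun x => ?_) hp
  rw [lintegral_count]
  refine enorm_tsum_le_tsum_enorm.trans_eq (tsum_congr fun k => ?_)
  rw [enorm_smul]

lemma memLp_latticeSynthesis [CompleteSpace B] (hψ : IsSamplingKernel ψ M)
    {f : (Fin d → ℤ) → B} (hf : Summable fun k => ‖f k‖) {p : ℝ} (hp : 1 ≤ p)
    (hfp : MemLp f (ENNReal.ofReal p) Measure.count) :
    MemLp (latticeSynthesis ψ f) (ENNReal.ofReal p) volume :=
  ⟨(hψ.continuous_latticeSynthesis hf).aestronglyMeasurable,
    (hψ.eLpNorm_latticeSynthesis_le f hp).trans_lt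
      (ENNReal.mul_lt_top ENNReal.coe_lt_top hfp.2)⟩

lemma enorm_latticeSample_le (ψ : SchwartzMap (EuclideanSpace ℝ (Fin d)) ℂ)
    (g : EuclideanSpace ℝ (Fin d) → A) (n : Fin d → ℤ) :
    ‖latticeSample ψ g n‖ₑ ≤ ∫⁻ y, ‖ψ (latticePoint n - y)‖ₑ * ‖g y‖ₑ := by
  refine (enorm_integral_le_lintegral_enorm _).trans_eq (lintegral_congr fun y => ?_)
  rw [enorm_smul]

/-- The endpoint r = ∞, which the version of Schur's test above does not cover; only the L^1 norm of
ψ enters. -/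
lemma enorm_latticeSample_le_eLpNorm_top (hψ : IsSamplingKernel ψ M)
    (g : EuclideanSpace ℝ (Fin d) → A) (n : Fin d → ℤ) :
    ‖latticeSample ψ g n‖ₑ ≤ M * eLpNorm g ∞ volume := by
  refine (enorm_latticeSample_le ψ g n).trans ?_
  calc _ ≤ ∫⁻ y, ‖ψ (latticePoint n - y)‖ₑ * eLpNorm g ∞ volume := by
        refine lintegral_mono_ae ?_
        filter_upwards [ae_le_eLpNormEssSup (f := g) (μ := volume)] with y hy
        rw [eLpNorm_exponent_top]
        gcongr
    _ = (∫⁻ y, ‖ψ (latticePoint n - y)‖ₑ) * eLpNorm g ∞ volume :=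
        lintegral_mul_const _
          (ψ.continuous.comp (continuous_sub_left (latticePoint n))).enorm.measurable
    _ ≤ _ := by
        gcongr
        exact hψ.lintegral_sub_left_le _

lemma eLpNorm_latticeSample_le (hψ : IsSamplingKernel ψ M)
    {g : EuclideanSpace ℝ (Fin d) → A} (hg : AEStronglyMeasurable g volume)
    {r : ℝ} (hr : 1 ≤ r) :
    eLpNorm (latticeSample ψ g) (ENNReal.ofReal r) Measure.count ≤
      M * eLpNorm g (ENNReal.ofReal r) volume :=
  eLpNorm_le_of_enorm_le_lintegral_mul (measurable_kernel' ψ) ENNReal.coe_ne_top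
    (fun k => hψ.lintegral_sub_left_le _)
    (fun x => by simpa only [lintegral_count] using hψ.tsum_sub_le' x) hg
    (enorm_latticeSample_le ψ g) hr

/-- Hölder, as ψ lies in every L^{r'}. Absolute convergence is what lets the embeddings into S pass
through the sampling integral. -/
lemma integrable_smul_of_memLp {g : EuclideanSpace ℝ (Fin d) → A} {r : ℝ≥0∞} (hr : 1 ≤ r)
    (ψ : SchwartzMap (EuclideanSpace ℝ (Fin d)) ℂ)
    (hg : MemLp g r volume) (a : EuclideanSpace ℝ (Fin d)) :
    Integrable (fun y => ψ (a - y) • g y) := by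
  have : ENNReal.HolderConjugate (ENNReal.conjExponent r) r :=
    (ENNReal.HolderConjugate.conjExponent hr).symm
  have h := (ψ.memLp (ENNReal.conjExponent r) volume).comp_measurePreserving
    (Measure.measurePreserving_sub_left volume a)
  exact memLp_one_iff_integrable.1 (hg.smul h)

/-- Convolution with `ψ` reproduces functions with Fourier transform supported in the cube. -/
lemma latticeSample_fourierInv [CompleteSpace S] (hψ : IsSamplingKernel ψ M)
    {G : EuclideanSpace ℝ (Fin d) → S} (hG : Integrable G) (hG0 : ∀ ξ, ξ ∉ cube d 1 → G ξ = 0)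
    (n : Fin d → ℤ) : latticeSample ψ (𝓕⁻ G) n = 𝓕⁻ G (latticePoint n) := by
  set a := latticePoint n
  have h1 : latticeSample ψ (𝓕⁻ G) n = ∫ y, ψ (y + a) • 𝓕 G y := by
    rw [latticeSample, ← integral_neg_eq_self]
    refine integral_congr_ae (.of_forall fun y => ?_)
    simp only [Real.fourierInv_eq_fourier_neg, neg_neg, sub_neg_eq_add]
    rw [add_comm]
  -- The transform is moved from G onto ψ(· + a), where it becomes the character of a times that of
  -- ψ; the latter factor is 1 wherever G does not vanish.
  have h2 := VectorFourier.integral_fourierIntegral_smul_eq_flip (μ := volume) (ν := volume)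
    (e := Real.fourierChar) (L := innerₗ (EuclideanSpace ℝ (Fin d)))
    (f := fun y => ψ (y + a)) (g := G) Real.continuous_fourierChar continuous_inner
    (ψ.integrable.comp_add_right a) hG
  rw [flip_innerₗ] at h2
  rw [h1]
  refine h2.symm.trans ?_
  rw [Real.fourierInv_eq]
  refine integral_congr_ae (.of_forall fun ξ => ?_)
  by_cases hξ : ξ ∈ cube d 1
  · have h3 := congrFun (VectorFourier.fourierIntegral_comp_add_right Real.fourierChar volume
      (innerₗ (EuclideanSpace ℝ (Fin d))) ψ a) ξ
    have h4 := hψ.fourier_eq_one ξ hξ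
    simp only [Function.comp_def] at h3
    dsimp only
    rw [h3]
    change (Real.fourierChar (inner ℝ a ξ) • 𝓕 (ψ : EuclideanSpace ℝ (Fin d) → ℂ) ξ) • G ξ = _
    rw [h4, real_inner_comm, smul_assoc, one_smul]
  · simp [hG0 ξ hξ]

/-- Translation by k turns into the factor e^{-2πi k·ξ}. Sum and integral commute because the L^1
norms of the terms add up to ‖ψ‖_1 ∑ ‖f(k)‖. -/
lemma fourier_latticeSynthesis [CompleteSpace B] (hψ : IsSamplingKernel ψ M)
    {f : (Fin d → ℤ) → B} (hf : Summable fun k => ‖f k‖) (ξ : EuclideanSpace ℝ (Fin d)) :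
    𝓕 (latticeSynthesis ψ f) ξ =
      𝓕 (ψ : EuclideanSpace ℝ (Fin d) → ℂ) ξ • latticeFourier f ξ := by
  have hshift : ∀ k : Fin d → ℤ, ∫ x, Real.fourierChar (-inner ℝ x ξ) • ψ (x - latticePoint k) =
      latticeChar (-k) ξ * 𝓕 (ψ : EuclideanSpace ℝ (Fin d) → ℂ) ξ := by
    intro k
    have h3 := congrFun (VectorFourier.fourierIntegral_comp_add_right Real.fourierChar volume
      (innerₗ (EuclideanSpace ℝ (Fin d))) ψ (latticePoint (-k))) ξ
    rw [latticeChar_eq_fourierChar, real_inner_comm]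
    simp only [Function.comp_def, latticePoint_neg, ← sub_eq_add_neg] at h3
    rw [latticePoint_neg]
    exact h3
  have hint : ∀ k : Fin d → ℤ,
      Integrable fun x => Real.fourierChar (-inner ℝ x ξ) • ψ (x - latticePoint k) := fun k =>
    (Real.fourierIntegral_convergent_iff ξ).2 (ψ.integrable.comp_sub_right (latticePoint k))
  rw [Real.fourier_eq, latticeFourier_eq, ← (summable_latticeFourier hf ξ).tsum_const_smul]
  have e1 : ∀ x, Real.fourierChar (-inner ℝ x ξ) • latticeSynthesis ψ f x =
      ∑' k, (Real.fourierChar (-inner ℝ x ξ) • ψ (x - latticePoint k)) • f k := by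
    intro x
    simp only [latticeSynthesis, smul_assoc]
    refine (Summable.tsum_const_smul _ ?_).symm
    refine Summable.of_norm_bounded (g := fun k => M * ‖f k‖) (hf.mul_left _) fun k => ?_
    rw [norm_smul]
    gcongr
    exact hψ.norm_le _
  simp only [e1]
  rw [← integral_tsum_of_summable_integral_norm]
  · refine tsum_congr fun k => ?_
    rw [integral_smul_const, hshift, mul_comm, mul_smul]
  · exact fun k => (hint k).smul_const _
  · have : ∀ k, ∫ x, ‖(Real.fourierChar (-inner ℝ x ξ) • ψ (x - latticePoint k)) • f k‖ =
        (∫ x, ‖ψ x‖) * ‖f k‖ := by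
      intro k
      simp only [norm_smul, Circle.norm_smul]
      rw [integral_mul_const, integral_sub_right_eq_self (fun x => ‖ψ x‖)]
    simp only [this]
    exact hf.mul_left _

/-- The transform of ψ is invisible here: it is 1 on the cube, and m is 0 off it. -/
lemma contMultiplierOp_latticeSynthesis [CompleteSpace B] (hψ : IsSamplingKernel ψ M)
    {f : (Fin d → ℤ) → B} (hf : Summable fun k => ‖f k‖)
    {m : EuclideanSpace ℝ (Fin d) → (B →L[ℂ] S)} (hm : ∀ ξ, ξ ∉ cube d 1 → m ξ = 0)
    (n : Fin d → ℤ) :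
    contMultiplierOp m (latticeSynthesis ψ f) (latticePoint n) = unfoldedMultiplierOp m f n := by
  rw [contMultiplierOp, Real.fourierInv_eq, unfoldedMultiplierOp]
  refine integral_congr_ae (.of_forall fun ξ => ?_)
  by_cases hξ : ξ ∈ cube d 1
  · simp only [hψ.fourier_latticeSynthesis hf, hψ.fourier_eq_one ξ hξ, one_smul,
      latticeChar_eq_fourierChar]
    rfl
  · simp [hm ξ hξ]

end IsSamplingKernel

end Kernel

/-! ### Transferring decompositions from ℝ^d to ℤ^d. -/

section Decomposition

variable {d : ℕ} {B S : Type*} [NormedAddCommGroup B] [NormedSpace ℂ B]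
  [NormedAddCommGroup S] [NormedSpace ℂ S]

lemma volume_cube_one : volume (cube d 1) = 1 := by
  rw [← measure_congr halfOpenCube_ae_eq_cube, volume_halfOpenCube]

lemma isClosed_cube (q : ℕ) : IsClosed (cube d q) := by
  have : cube d q = ⋂ i : Fin d, {ξ | |ξ i| ≤ 1 / 2 / (q : ℝ)} := by
    ext ξ; simp [cube]
  rw [this]
  exact isClosed_iInter fun i => isClosed_le (by fun_prop) continuous_const

lemma cube_subset_cube_one {q : ℕ} (hq : 0 < q) : cube d q ⊆ cube d 1 := by
  intro ξ hξ i
  refine (hξ i).trans ?_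
  have : (1 : ℝ) ≤ q := by exact_mod_cast hq
  gcongr
  exact_mod_cast hq

lemma integrable_clm_apply_of_cube {m : EuclideanSpace ℝ (Fin d) → (B →L[ℂ] S)}
    (hm : AEStronglyMeasurable m volume) {Mb : ℝ} (hMb : ∀ ξ, ‖m ξ‖ ≤ Mb)
    (hm0 : ∀ ξ, ξ ∉ cube d 1 → m ξ = 0)
    {u : EuclideanSpace ℝ (Fin d) → B} (hu : Continuous u) {K : ℝ} (hK : ∀ ξ, ‖u ξ‖ ≤ K) :
    Integrable fun ξ => m ξ (u ξ) := by
  have hmeas : AEStronglyMeasurable (fun ξ => m ξ (u ξ)) volume :=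
    isBoundedBilinearMap_apply.continuous.comp_aestronglyMeasurable
      (hm.prodMk hu.aestronglyMeasurable)
  have hon : IntegrableOn (fun ξ => m ξ (u ξ)) (cube d 1) := by
    refine IntegrableOn.of_bound (by simp [volume_cube_one]) hmeas.restrict (Mb * K)
      (.of_forall fun ξ => ?_)
    exact (m ξ).le_of_opNorm_le_of_le (hMb ξ) (hK ξ)
  refine (integrableOn_iff_integrable_of_support_subset fun ξ hξ => ?_).1 hon
  by_contra h
  exact hξ (by simp [hm0 ξ h])

variable {A₀ A₁ : Type*} [NormedAddCommGroup A₀] [NormedSpace ℂ A₀]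
  [NormedAddCommGroup A₁] [NormedSpace ℂ A₁]

lemma exists_memLp_of_bochnerNorm_lt {X A : Type*} [MeasurableSpace X] {μ : Measure X}
    [NormedAddCommGroup A] [NormedSpace ℂ A] {ι : A →L[ℂ] S} {r : ℝ≥0∞} {h : X → S} {c : ℝ≥0∞}
    (hc : bochnerNorm μ ι r h < c) :
    ∃ g : X → A, MemLp g r μ ∧ (h =ᵐ[μ] fun x => ι (g x)) ∧ eLpNorm g r μ < c := by
  simpa only [bochnerNorm, iInf_lt_iff, exists_prop] using hc

lemma bochnerNorm_le {X A : Type*} [MeasurableSpace X] {μ : Measure X}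
    [NormedAddCommGroup A] [NormedSpace ℂ A] {ι : A →L[ℂ] S} {r : ℝ≥0∞} {h : X → S}
    {g : X → A} (hg : MemLp g r μ) (hgh : h =ᵐ[μ] fun x => ι (g x)) :
    bochnerNorm μ ι r h ≤ eLpNorm g r μ :=
  iInf_le_of_le g (iInf_le_of_le hg (iInf_le_of_le hgh le_rfl))

lemma peetreK_le {V : Type*} [Add V] {N₀ N₁ : V → ℝ≥0∞} {t : ℝ≥0∞} {a a₀ a₁ : V}
    (h : a₀ + a₁ = a) : peetreK N₀ N₁ t a ≤ N₀ a₀ + t * N₁ a₁ :=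
  iInf_le_of_le a₀ (iInf_le_of_le a₁ (iInf_le_of_le h le_rfl))

lemma exists_add_eq_of_peetreK_lt {V : Type*} [Add V] {N₀ N₁ : V → ℝ≥0∞} {t c : ℝ≥0∞} {a : V}
    (h : peetreK N₀ N₁ t a < c) : ∃ a₀ a₁, a₀ + a₁ = a ∧ N₀ a₀ + t * N₁ a₁ < c := by
  simpa only [peetreK, iInf_lt_iff, exists_prop] using h

lemma CompatiblePair.finiteDimensional [FiniteDimensional ℂ A₀] [FiniteDimensional ℂ A₁]
    (P : CompatiblePair A₀ A₁ S) : FiniteDimensional ℂ S := by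
  refine FiniteDimensional.of_surjective
    ((P.ι₀ : A₀ →ₗ[ℂ] S).coprod (P.ι₁ : A₁ →ₗ[ℂ] S)) fun s => ?_
  obtain ⟨a, b, hab⟩ := P.exists_add_eq s
  exact ⟨(a, b), by simpa using hab⟩

/-- The bound `K(t, T F) ≤ N t^θ ‖F‖_p` for all `t`, where `T` has the multiplier `m`, and `K` is
the `K`-functional of `L^∞(A₀)` and `L^{θp}(A₁)`. -/
def KBound (P : CompatiblePair A₀ A₁ S) (p θ : ℝ) (N : ℝ≥0∞)
    (m : EuclideanSpace ℝ (Fin d) → (B →L[ℂ] S)) : Prop :=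
  ∀ F : EuclideanSpace ℝ (Fin d) → B, MemLp F 1 volume → MemLp F (ENNReal.ofReal p) volume →
    ∀ t : ℝ≥0∞, t ≠ 0 → t ≠ ∞ →
      peetreK (bochnerNorm volume P.ι₀ ∞) (bochnerNorm volume P.ι₁ (ENNReal.ofReal (θ * p))) t
        (contMultiplierOp m F) ≤ N * t ^ θ * eLpNorm F (ENNReal.ofReal p) volume

/-- A near-optimal decomposition of T F, with F synthesized from f, is convolved with ψ and sampled.
Synthesis and sampling each cost one factor M + 1. The pieces themselves are returned, with separate
bounds, since the residue classes are later glued piece by piece. -/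
lemma KBound.exists_decomposition [FiniteDimensional ℂ A₀] [FiniteDimensional ℂ A₁]
    [CompleteSpace B] {P : CompatiblePair A₀ A₁ S} {p θ : ℝ} {N : ℝ≥0∞}
    {m : EuclideanSpace ℝ (Fin d) → (B →L[ℂ] S)} (hN : KBound P p θ N m)
    (hN0 : N ≠ 0) (hNtop : N ≠ ∞) (hp : 1 ≤ p) (hpθ : 1 ≤ θ * p) (hθ : 0 ≤ θ)
    (hm : AEStronglyMeasurable m volume) {Mb : ℝ} (hMb : ∀ ξ, ‖m ξ‖ ≤ Mb)
    (hm0 : ∀ ξ, ξ ∉ cube d 1 → m ξ = 0)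
    {ψ : SchwartzMap (EuclideanSpace ℝ (Fin d)) ℂ} {M : ℝ≥0} (hψ : IsSamplingKernel ψ M)
    {f : (Fin d → ℤ) → B} (hf : Summable fun k => ‖f k‖)
    (hfp : MemLp f (ENNReal.ofReal p) Measure.count) {t : ℝ≥0∞} (ht0 : t ≠ 0) (ht : t ≠ ∞) :
    ∃ (g₀ : (Fin d → ℤ) → A₀) (g₁ : (Fin d → ℤ) → A₁),
      (∀ n, P.ι₀ (g₀ n) + P.ι₁ (g₁ n) = unfoldedMultiplierOp m f n) ∧
      (∀ n, ‖g₀ n‖ₑ ≤ (M + 1) ^ 2 * (N * t ^ θ * eLpNorm f (ENNReal.ofReal p) Measure.count)) ∧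
      t * eLpNorm g₁ (ENNReal.ofReal (θ * p)) Measure.count ≤
        (M + 1) ^ 2 * (N * t ^ θ * eLpNorm f (ENNReal.ofReal p) Measure.count) := by
  have : FiniteDimensional ℂ S := P.finiteDimensional
  have : CompleteSpace S := FiniteDimensional.complete ℂ S
  have : CompleteSpace A₀ := FiniteDimensional.complete ℂ A₀
  have : CompleteSpace A₁ := FiniteDimensional.complete ℂ A₁
  have hp0 : 0 < p := by linarith
  -- For f = 0 the bound is 0 and there is no room for the strict inequality used below.
  by_cases hf0 : eLpNorm f (ENNReal.ofReal p) Measure.count = 0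
  · have hfz : f = 0 := by
      rw [eLpNorm_eq_zero_iff hfp.1 (by simpa using hp0)] at hf0
      exact funext fun k => by simpa using (Measure.ae_count_iff.1 hf0 k)
    refine ⟨0, 0, fun n => ?_, fun n => by simp, by simp⟩
    subst hfz
    simp [unfoldedMultiplierOp, latticeFourier]
  set F := latticeSynthesis ψ f with hF
  have hf1 : MemLp f (ENNReal.ofReal 1) Measure.count := by
    rw [ENNReal.ofReal_one, memLp_one_iff_integrable, integrable_count_iff]; exact hf
  have hF1 : MemLp F 1 volume := by
    simpa using hψ.memLp_latticeSynthesis hf le_rfl hf1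
  -- M + 1 instead of M makes the bound on K strict, so that some decomposition in the infimum
  -- satisfies it.
  set κ := N * t ^ θ * ((M + 1) * eLpNorm f (ENNReal.ofReal p) Measure.count) with hκ
  have htθ0 : t ^ θ ≠ 0 := by simp [ENNReal.rpow_eq_zero_iff, ht0, ht]
  have htθ : t ^ θ ≠ ∞ := ENNReal.rpow_ne_top_of_nonneg hθ ht
  have hlt : peetreK (bochnerNorm volume P.ι₀ ∞)
      (bochnerNorm volume P.ι₁ (ENNReal.ofReal (θ * p))) t (contMultiplierOp m F) < κ := by
    refine (hN F hF1 (hψ.memLp_latticeSynthesis hf hp hfp) t ht0 ht).trans_lt ?_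
    refine (ENNReal.mul_lt_mul_iff_right (mul_ne_zero hN0 htθ0)
      (ENNReal.mul_ne_top hNtop htθ)).2 ?_
    refine (hψ.eLpNorm_latticeSynthesis_le f hp).trans_lt ?_
    refine (ENNReal.mul_lt_mul_iff_left hf0 hfp.2.ne).2 ?_
    exact ENNReal.lt_add_right ENNReal.coe_ne_top one_ne_zero
  obtain ⟨a₀, a₁, hadd, hsum⟩ := exists_add_eq_of_peetreK_lt hlt
  obtain ⟨h₀, hh₀, ha₀, hn₀⟩ :=
    exists_memLp_of_bochnerNorm_lt (le_self_add.trans_lt hsum)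
  obtain ⟨h₁, hh₁, ha₁, hn₁⟩ := exists_memLp_of_bochnerNorm_lt
    ((ENNReal.lt_div_iff_mul_lt (Or.inl ht0) (Or.inl ht)).2
      (by rw [mul_comm]; exact le_add_self.trans_lt hsum))
  have hr1 : 1 ≤ ENNReal.ofReal (θ * p) := by simpa using hpθ
  have hMκ : M * κ ≤
      (M + 1) ^ 2 * (N * t ^ θ * eLpNorm f (ENNReal.ofReal p) Measure.count) := by
    calc M * κ ≤ (M + 1) * κ := by gcongr; exact le_self_add
      _ = _ := by rw [hκ]; ring
  refine ⟨latticeSample ψ h₀, latticeSample ψ h₁, fun n => ?_, fun n => ?_, ?_⟩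
  · have hi₀ := IsSamplingKernel.integrable_smul_of_memLp le_top ψ hh₀ (latticePoint n)
    have hi₁ := IsSamplingKernel.integrable_smul_of_memLp hr1 ψ hh₁ (latticePoint n)
    have hG : Integrable fun ξ => m ξ (𝓕 F ξ) := by
      have := integrable_clm_apply_of_cube hm hMb hm0 (continuous_latticeFourier hf)
        (norm_latticeFourier_le hf)
      refine this.congr (.of_forall fun ξ => ?_)
      by_cases hξ : ξ ∈ cube d 1
      · simp only [hF, hψ.fourier_latticeSynthesis hf, hψ.fourier_eq_one ξ hξ, one_smul]
      · simp [hm0 ξ hξ]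
    rw [latticeSample, latticeSample, ← P.ι₀.integral_comp_comm hi₀,
      ← P.ι₁.integral_comp_comm hi₁, ← integral_add (P.ι₀.integrable_comp hi₀)
        (P.ι₁.integrable_comp hi₁), ← hψ.contMultiplierOp_latticeSynthesis hf hm0 n]
    change _ = 𝓕⁻ (fun ξ => m ξ (𝓕 F ξ)) (latticePoint n)
    -- Rewriting the point value as an integral against ψ makes the almost everywhere identities
    -- `ha₀` and `ha₁` usable.
    rw [← hψ.latticeSample_fourierInv hG (fun ξ hξ => by simp [hm0 ξ hξ])]
    refine integral_congr_ae ?_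
    filter_upwards [ha₀, ha₁] with y hy₀ hy₁
    have := congrFun hadd y
    simp only [Pi.add_apply, contMultiplierOp] at this
    rw [← this, hy₀, hy₁, map_smul, map_smul, smul_add]
  · exact (hψ.enorm_latticeSample_le_eLpNorm_top h₀ n).trans
      (le_trans (by gcongr) hMκ)
  · refine le_trans ?_ hMκ
    calc t * eLpNorm (latticeSample ψ h₁) (ENNReal.ofReal (θ * p)) Measure.count
        ≤ t * (M * (κ / t)) := by
          gcongr
          refine (hψ.eLpNorm_latticeSample_le hh₁.1 hpθ).trans ?_
          gcongr
      _ = M * κ := by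
          rw [mul_left_comm, ENNReal.mul_div_cancel ht0 ht]

end Decomposition

/-! ### Unfolding the periodized multiplier -/

/-- The representative of a residue class modulo `q` in `ℤ^d`. -/
def latticeResidue {d q : ℕ} (s : Fin d → Fin q) : Fin d → ℤ := fun i => (s i : ℤ)

/-- Division with remainder by `q` on `ℤ^d`. -/
def latticeDivMod (d q : ℕ) [NeZero q] : (Fin d → ℤ) ≃ (Fin d → ℤ) × (Fin d → Fin q) :=
  (Equiv.arrowCongr (Equiv.refl _) (Int.divModEquiv q)).trans
    (Equiv.arrowProdEquivProdArrow _ _ _)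

section Periodization

variable {d : ℕ} {B S : Type*} [NormedAddCommGroup B] [NormedSpace ℂ B]
  [NormedAddCommGroup S] [NormedSpace ℂ S] {q : ℕ}

lemma latticeDivMod_symm_apply [NeZero q] (k : Fin d → ℤ) (s : Fin d → Fin q) :
    (latticeDivMod d q).symm (k, s) = (q : ℤ) • k + latticeResidue s := by
  ext i
  simp only [Pi.add_apply, Pi.smul_apply, smul_eq_mul, latticeResidue, mul_comm (q : ℤ)]
  rfl

/-- A geometric sum in the q-th root of unity e^{2πi j/q}, which is 1 exactly when q divides j. -/
lemma sum_exp_mul_div (hq : 0 < q) (j : ℤ) :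
    ∑ s : Fin q, Complex.exp ((2 * Real.pi * (j * ((s : ℕ) / (q : ℝ))) : ℝ) * Complex.I) =
      if (q : ℤ) ∣ j then (q : ℂ) else 0 := by
  have hq0 : (q : ℂ) ≠ 0 := by exact_mod_cast hq.ne'
  set x : ℂ := Complex.exp (2 * Real.pi * Complex.I * (j / q)) with hx
  have hterm : ∀ s : ℕ,
      Complex.exp ((2 * Real.pi * (j * (s / (q : ℝ))) : ℝ) * Complex.I) = x ^ s := by
    intro s
    rw [hx, ← Complex.exp_nat_mul]
    congr 1; push_cast; ring
  have hxq : x ^ q = 1 := by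
    rw [hx, ← Complex.exp_nat_mul, Complex.exp_eq_one_iff]
    exact ⟨j, by field_simp⟩
  simp only [hterm]
  rw [Fin.sum_univ_eq_sum_range (fun s => x ^ s)]
  split_ifs with h
  · obtain ⟨c, rfl⟩ := h
    have : x = 1 := by
      rw [hx, Complex.exp_eq_one_iff]
      exact ⟨c, by push_cast; field_simp⟩
    simp [this]
  · have hx1 : x ≠ 1 := by
      intro h1
      rw [hx, Complex.exp_eq_one_iff] at h1
      obtain ⟨c, hc⟩ := h1
      apply h
      refine ⟨c, ?_⟩
      have h2 : (2 * Real.pi * Complex.I : ℂ) ≠ 0 := Complex.two_pi_I_ne_zero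
      have h3 : (j : ℂ) / q = c := mul_left_cancel₀ h2 (by rw [hc]; ring)
      rw [div_eq_iff hq0] at h3
      have h4 : (j : ℂ) = ((q * c : ℤ) : ℂ) := by rw [h3]; push_cast; ring
      exact_mod_cast h4
    rw [geom_sum_eq hx1, hxq, sub_self, zero_div]

lemma sum_latticeChar_residue (hq : 0 < q) (j : Fin d → ℤ) :
    ∑ s : Fin d → Fin q, latticeChar j ((q : ℝ)⁻¹ • latticePoint (latticeResidue s)) =
      if ∀ i, (q : ℤ) ∣ j i then (q : ℂ) ^ d else 0 := by
  have h1 : ∀ s : Fin d → Fin q, latticeChar j ((q : ℝ)⁻¹ • latticePoint (latticeResidue s)) =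
      ∏ i, Complex.exp ((2 * Real.pi * (j i * ((s i : ℕ) / (q : ℝ))) : ℝ) * Complex.I) := by
    intro s
    rw [← Complex.exp_sum, latticeChar, ← Finset.sum_mul, latticePairing, Finset.mul_sum,
      Complex.ofReal_sum]
    congr 2
    refine Finset.sum_congr rfl fun i _ => ?_
    simp only [PiLp.smul_apply, latticePoint_apply, latticeResidue, smul_eq_mul]
    push_cast; ring
  simp only [h1]
  rw [← Fintype.prod_sum (fun i (s : Fin q) =>
    Complex.exp ((2 * Real.pi * (j i * ((s : ℕ) / (q : ℝ))) : ℝ) * Complex.I))]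
  simp only [sum_exp_mul_div hq]
  split_ifs with h
  · simp [h]
  · push Not at h
    obtain ⟨i, hi⟩ := h
    exact Finset.prod_eq_zero (Finset.mem_univ i) (by simp [hi])

lemma latticeChar_latticePoint (n k : Fin d → ℤ) : latticeChar n (latticePoint k) = 1 := by
  rw [latticeChar, Complex.exp_eq_one_iff]
  refine ⟨∑ i, n i * k i, ?_⟩
  simp only [latticePairing, latticePoint_apply]
  push_cast
  ring

lemma latticeChar_sub_latticePoint (n k : Fin d → ℤ) (ξ : EuclideanSpace ℝ (Fin d)) :
    latticeChar n (ξ - latticePoint k) = latticeChar n ξ := by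
  rw [sub_eq_add_neg, ← latticePoint_neg, latticeChar_add_right, latticeChar_latticePoint, mul_one]

lemma latticeFourier_sub_latticePoint (f : (Fin d → ℤ) → B) (k : Fin d → ℤ)
    (ξ : EuclideanSpace ℝ (Fin d)) :
    latticeFourier f (ξ - latticePoint k) = latticeFourier f ξ := by
  simp only [latticeFourier_eq, latticeChar_sub_latticePoint]

lemma latticeChar_zsmul (c : ℤ) (n : Fin d → ℤ) (ξ : EuclideanSpace ℝ (Fin d)) :
    latticeChar (c • n) ξ = latticeChar n ((c : ℝ) • ξ) := by
  have h : latticePairing (c • n) ξ = c * latticePairing n ξ := by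
    rw [latticePairing, latticePairing, Finset.mul_sum]
    exact Finset.sum_congr rfl fun i _ => by simp [mul_assoc]
  rw [latticeChar, latticeChar, latticePairing_smul_right, h]

/-- Averaging over the shifts by `(ℤ/q)^d` selects a residue class. -/
lemma sum_latticeChar_smul_latticeFourier [CompleteSpace B] (hq : 0 < q) {f : (Fin d → ℤ) → B}
    (hf : Summable fun k => ‖f k‖) (n : Fin d → ℤ) (s₀ : Fin d → Fin q)
    (ξ : EuclideanSpace ℝ (Fin d)) :
    ∑ s : Fin d → Fin q,
        latticeChar ((q : ℤ) • n + latticeResidue s₀)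
          (ξ + (q : ℝ)⁻¹ • latticePoint (latticeResidue s)) •
        latticeFourier f (ξ + (q : ℝ)⁻¹ • latticePoint (latticeResidue s)) =
      (q : ℂ) ^ d • latticeChar n ((q : ℝ) • ξ) •
        latticeFourier (fun k => f ((q : ℤ) • k + latticeResidue s₀)) ((q : ℝ) • ξ) := by
  set N := (q : ℤ) • n + latticeResidue s₀ with hN
  set a : (Fin d → Fin q) → EuclideanSpace ℝ (Fin d) :=
    fun s => (q : ℝ)⁻¹ • latticePoint (latticeResidue s) with ha
  have hterm : ∀ s, latticeChar N (ξ + a s) • latticeFourier f (ξ + a s) =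
      ∑' k, (latticeChar (N - k) ξ * latticeChar (N - k) (a s)) • f k := by
    intro s
    rw [latticeFourier_eq, ← (summable_latticeFourier hf _).tsum_const_smul]
    refine tsum_congr fun k => ?_
    rw [smul_smul, ← latticeChar_add, ← latticeChar_add_right, sub_eq_add_neg]
  have hsummable : ∀ s, Summable fun k =>
      (latticeChar (N - k) ξ * latticeChar (N - k) (a s)) • f k := fun s =>
    Summable.of_norm (by simpa only [norm_smul, norm_mul, norm_latticeChar, one_mul] using hf)
  change ∑ s, latticeChar N (ξ + a s) • latticeFourier f (ξ + a s) = _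
  simp only [hterm]
  rw [← Summable.tsum_finsetSum fun s _ => hsummable s]
  have hsum : ∀ k, ∑ s, (latticeChar (N - k) ξ * latticeChar (N - k) (a s)) • f k =
      (latticeChar (N - k) ξ * if ∀ i, (q : ℤ) ∣ (N - k) i then (q : ℂ) ^ d else 0) • f k := by
    intro k
    rw [← Finset.sum_smul, ← Finset.mul_sum, sum_latticeChar_residue hq]
  simp only [hsum]
  have hinj : Function.Injective fun k : Fin d → ℤ => (q : ℤ) • k + latticeResidue s₀ := by
    intro k k' h
    ext i
    have := congrFun h i
    simpa [hq.ne'] using this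
  -- Only the k congruent to `s₀` modulo q survive, and these are the values of the injection.
  rw [← hinj.tsum_eq]
  · rw [latticeFourier_eq, ← tsum_const_smul'', ← tsum_const_smul'']
    refine tsum_congr fun k => ?_
    have hNk : N - ((q : ℤ) • k + latticeResidue s₀) = (q : ℤ) • (n - k) := by
      rw [hN, smul_sub]; abel
    rw [hNk, if_pos (fun i => by simp), latticeChar_zsmul, sub_eq_add_neg, latticeChar_add,
      smul_smul, smul_smul]
    congr 1
    push_cast
    ring
  · intro k hk
    have hdvd : ∀ i, (q : ℤ) ∣ (N - k) i := by
      by_contra hcon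
      exact hk (by simp only [if_neg hcon, mul_zero, zero_smul])
    choose c hc using hdvd
    refine ⟨n - c, ?_⟩
    ext i
    have := hc i
    simp only [Pi.sub_apply, Pi.add_apply, Pi.smul_apply, smul_eq_mul, hN] at this ⊢
    linear_combination this

/-- The shifts of the cube of side `1/q` which meet the unit cube. -/
lemma finite_setOf_shift_mem_cube (hq : 0 < q) : {l : Fin d → ℤ | ∃ ξ ∈ cube d 1,
    ξ - (q : ℝ)⁻¹ • latticePoint l ∈ cube d q}.Finite := by
  refine (Set.finite_Icc (fun _ : Fin d => -((q : ℤ) + 1)) (fun _ => (q : ℤ) + 1)).subset ?_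
  rintro l ⟨ξ, h1, h2⟩
  have hq0 : (0 : ℝ) < q := by exact_mod_cast hq
  have key : ∀ i, |(l i : ℝ)| ≤ q + 1 := by
    intro i
    have h1i := h1 i
    have h2i := h2 i
    simp only [PiLp.sub_apply, PiLp.smul_apply, latticePoint_apply, smul_eq_mul] at h2i
    have h3 : |(q : ℝ)⁻¹ * l i| ≤ 1 / 2 + 1 / 2 / q := by
      calc |(q : ℝ)⁻¹ * l i| = |ξ i - (ξ i - (q : ℝ)⁻¹ * l i)| := by ring_nf
        _ ≤ |ξ i| + |ξ i - (q : ℝ)⁻¹ * l i| := abs_sub _ _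
        _ ≤ _ := by
          norm_num at h1i
          gcongr
    rw [abs_mul, abs_of_pos (by positivity), inv_mul_le_iff₀ hq0] at h3
    have h4 : (q : ℝ) * (1 / 2 + 1 / 2 / q) = q / 2 + 1 / 2 := by field_simp
    rw [h4] at h3
    linarith
  constructor
  · intro i
    have := (abs_le.1 (key i)).1
    have h : (-((q : ℤ) + 1) : ℤ) ≤ l i := by exact_mod_cast this
    exact h
  · intro i
    have := (abs_le.1 (key i)).2
    have h : l i ≤ ((q : ℤ) + 1 : ℤ) := by exact_mod_cast this
    exact h

/-- With l = qk + s the shift l/q is k + s/q. Since the character and the Fourier series of f are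
ℤ^d-periodic, summing over k unfolds the cube to ℝ^d; translating by s/q then frees m of its shift
and leaves a finite sum over s. -/
lemma latticeMultiplierOp_periodization_eq_integral [CompleteSpace B] [CompleteSpace S]
    (hq : 0 < q) {m : EuclideanSpace ℝ (Fin d) → (B →L[ℂ] S)}
    (hm : AEStronglyMeasurable m volume) {Mb : ℝ} (hMb : ∀ ξ, ‖m ξ‖ ≤ Mb)
    (hm0 : ∀ ξ, ξ ∉ cube d q → m ξ = 0)
    {f : (Fin d → ℤ) → B} (hf : Summable fun k => ‖f k‖) (n : Fin d → ℤ) :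
    latticeMultiplierOp (periodization q m) f n =
      ∫ ξ, m ξ (∑ s : Fin d → Fin q,
        latticeChar n (ξ + (q : ℝ)⁻¹ • latticePoint (latticeResidue s)) •
        latticeFourier f (ξ + (q : ℝ)⁻¹ • latticePoint (latticeResidue s))) := by
  have : NeZero q := ⟨hq.ne'⟩
  have hq0 : (q : ℝ) ≠ 0 := by exact_mod_cast hq.ne'
  have hm1 : ∀ ξ, ξ ∉ cube d 1 → m ξ = 0 := fun ξ hξ =>
    hm0 ξ fun h => hξ (cube_subset_cube_one hq h)
  set a : (Fin d → ℤ) → EuclideanSpace ℝ (Fin d) := fun l => (q : ℝ)⁻¹ • latticePoint l with ha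
  set u : EuclideanSpace ℝ (Fin d) → B := fun ξ => latticeChar n ξ • latticeFourier f ξ with hu
  have hucont : Continuous u := (continuous_latticeChar n).smul (continuous_latticeFourier hf)
  have hubd : ∀ ξ, ‖u ξ‖ ≤ ∑' k, ‖f k‖ := fun ξ => by
    rw [hu, norm_smul, norm_latticeChar, one_mul]; exact norm_latticeFourier_le hf ξ
  have huper : ∀ ξ k, u (ξ - latticePoint k) = u ξ := fun ξ k => by
    simp only [hu, latticeChar_sub_latticePoint, latticeFourier_sub_latticePoint]
  have hint : ∀ b, Integrable fun ξ => m ξ (u (ξ + b)) := fun b =>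
    integrable_clm_apply_of_cube hm hMb hm1 (hucont.comp (continuous_add_const b))
      (fun ξ => hubd (ξ + b))
  have hint' : ∀ b, Integrable fun ξ => m (ξ - b) (u ξ) := fun b => by
    simpa using (hint b).comp_sub_right b
  -- On the unit cube the periodization is a finite sum, so it commutes with evaluation and
  -- integration.
  obtain ⟨T, hT⟩ : ∃ T : Finset (Fin d → ℤ), ∀ l, l ∉ T → ∀ ξ ∈ cube d 1, m (ξ - a l) = 0 := by
    refine ⟨(finite_setOf_shift_mem_cube hq).toFinset, fun l hl ξ hξ => hm0 _ fun h => hl ?_⟩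
    simpa using ⟨ξ, hξ, h⟩
  have hper : ∀ ξ ∈ cube d 1,
      latticeChar n ξ • periodization q m ξ (latticeFourier f ξ) = ∑ l ∈ T, m (ξ - a l) (u ξ) := by
    intro ξ hξ
    have e : periodization q m ξ = ∑ l ∈ T, m (ξ - a l) := by
      refine Eq.trans (tsum_congr fun l => ?_) (tsum_eq_sum fun l hl => hT l hl ξ hξ)
      congr 2
      ext i
      simp [ha, latticePoint_apply, div_eq_inv_mul]
    rw [e, ← map_smul, sum_apply]
  have hcube : MeasurableSet (cube d 1) := (isClosed_cube 1).measurableSet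
  set I : (Fin d → ℤ) → S := fun l => ∫ ξ in cube d 1, m (ξ - a l) (u ξ) with hI
  have hI0 : ∀ l, l ∉ T → I l = 0 := fun l hl =>
    setIntegral_eq_zero_of_forall_eq_zero fun ξ hξ => by simp [hT l hl ξ hξ]
  have hIsum : Summable I := summable_of_ne_finset_zero (s := T) hI0
  have h1 : latticeMultiplierOp (periodization q m) f n = ∑' l, I l := by
    rw [tsum_eq_sum hI0, ← integral_finsetSum T fun l _ => (hint' (a l)).integrableOn]
    exact setIntegral_congr_fun hcube hper
  have hunfold : ∀ s : Fin d → Fin q,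
      HasSum (fun k => I ((q : ℤ) • k + latticeResidue s))
        (∫ ξ, m ξ (u (ξ + a (latticeResidue s)))) := by
    intro s
    have h := hasSum_setIntegral_halfOpenCube (hint' (a (latticeResidue s)))
    have e : ∫ ξ, m (ξ - a (latticeResidue s)) (u ξ) =
        ∫ ξ, m ξ (u (ξ + a (latticeResidue s))) := by
      rw [← integral_add_right_eq_self _ (a (latticeResidue s))]
      simp
    rw [e] at h
    convert h using 2 with k
    -- The half-open cubes tile ℝ^d disjointly, whereas the operator integrates over the closed one;
    -- they differ by a null set.
    rw [hI, setIntegral_congr_set halfOpenCube_ae_eq_cube]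
    refine setIntegral_congr_fun hcube fun ξ _ => ?_
    have e2 : ξ - a ((q : ℤ) • k + latticeResidue s) =
        ξ - latticePoint k - a (latticeResidue s) := by
      ext i
      simp only [ha, PiLp.sub_apply, PiLp.smul_apply, latticePoint_apply, Pi.add_apply,
        Pi.smul_apply, smul_eq_mul]
      push_cast
      field_simp
      ring
    simp only [e2, huper]
  rw [h1, ← (latticeDivMod d q).symm.tsum_eq I,
    ← (Equiv.prodComm _ _).tsum_eq, Summable.tsum_prod, tsum_fintype]
  · rw [← integral_congr_ae (.of_forall fun ξ => (map_sum (m ξ) _ Finset.univ).symm),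
      integral_finsetSum _ fun s _ => hint (a (latticeResidue s))]
    refine Finset.sum_congr rfl fun s _ => ?_
    simp only [Equiv.prodComm_apply, Prod.swap_prod_mk, latticeDivMod_symm_apply]
    exact (hunfold s).tsum_eq
  · exact ((latticeDivMod d q).symm.summable_iff.2 hIsum).comp_injective
      (Equiv.prodComm _ _).injective

/-- The operator on `ℤ^d` acts on each residue class modulo `q` by the dilated multiplier. -/
lemma latticeMultiplierOp_periodization [CompleteSpace B] [CompleteSpace S]
    (hq : 0 < q) {m : EuclideanSpace ℝ (Fin d) → (B →L[ℂ] S)}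
    (hm : AEStronglyMeasurable m volume) {Mb : ℝ} (hMb : ∀ ξ, ‖m ξ‖ ≤ Mb)
    (hm0 : ∀ ξ, ξ ∉ cube d q → m ξ = 0)
    {f : (Fin d → ℤ) → B} (hf : Summable fun k => ‖f k‖) (n : Fin d → ℤ) (s : Fin d → Fin q) :
    latticeMultiplierOp (periodization q m) f ((q : ℤ) • n + latticeResidue s) =
      unfoldedMultiplierOp (fun ξ => m ((q : ℝ)⁻¹ • ξ))
        (fun k => f ((q : ℤ) • k + latticeResidue s)) n := by
  have hq0 : (0 : ℝ) < q := by exact_mod_cast hq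
  rw [latticeMultiplierOp_periodization_eq_integral hq hm hMb hm0 hf]
  simp only [sum_latticeChar_smul_latticeFourier hq hf, map_smul]
  rw [integral_smul, unfoldedMultiplierOp]
  set g : EuclideanSpace ℝ (Fin d) → S := fun ξ => latticeChar n ξ •
    m ((q : ℝ)⁻¹ • ξ) (latticeFourier (fun k => f ((q : ℤ) • k + latticeResidue s)) ξ) with hg
  -- The Jacobian q^{-d} cancels the factor q^d produced by summing over the shifts.
  have h := Measure.integral_comp_smul volume g (q : ℝ)
  simp only [hg, inv_smul_smul₀ hq0.ne', finrank_euclideanSpace, Fintype.card_fin] at h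
  rw [h, abs_of_pos (by positivity)]
  rw [← Complex.coe_smul, smul_smul]
  push_cast
  rw [mul_inv_cancel₀ (by exact_mod_cast (pow_pos hq0 d).ne'), one_smul]

end Periodization

/-! ### Dilations -/

section Dilation

variable {d : ℕ} {A₀ A₁ B S : Type*} [NormedAddCommGroup A₀] [NormedSpace ℂ A₀]
  [NormedAddCommGroup A₁] [NormedSpace ℂ A₁] [NormedAddCommGroup B] [NormedSpace ℂ B]
  [NormedAddCommGroup S] [NormedSpace ℂ S]

/-- At r = ∞ the exponent `(1 / r).toReal` is 0, so the factor is 1 and the L^∞ norm is invariant.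
-/
lemma eLpNorm_comp_const_smul {F : Type*} [NormedAddCommGroup F] {c : ℝ} (hc : 0 < c)
    (g : EuclideanSpace ℝ (Fin d) → F) (r : ℝ≥0∞) :
    eLpNorm (fun x => g (c • x)) r volume =
      ENNReal.ofReal (c ^ d)⁻¹ ^ (1 / r).toReal * eLpNorm g r volume := by
  have h := (measurableEmbedding_const_smul₀ (α := EuclideanSpace ℝ (Fin d))
    hc.ne').eLpNorm_map_measure (p := r) (g := g) (μ := volume)
  rw [Measure.map_addHaar_smul volume hc.ne', finrank_euclideanSpace, Fintype.card_fin,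
    abs_of_pos (by positivity), eLpNorm_smul_measure_of_ne_zero
      (by simpa using pow_pos hc d), smul_eq_mul] at h
  exact h.symm

lemma quasiMeasurePreserving_const_smul {c : ℝ} (hc : c ≠ 0) :
    Measure.QuasiMeasurePreserving (fun x : EuclideanSpace ℝ (Fin d) => c • x) volume volume :=
  ⟨measurable_const_smul c, by
    rw [Measure.map_addHaar_smul volume hc]
    exact Measure.smul_absolutelyContinuous⟩

lemma memLp_comp_const_smul {F : Type*} [NormedAddCommGroup F] {c : ℝ} (hc : 0 < c)
    {g : EuclideanSpace ℝ (Fin d) → F} {r : ℝ≥0∞} (hg : MemLp g r volume) :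
    MemLp (fun x => g (c • x)) r volume := by
  refine ⟨hg.1.comp_quasiMeasurePreserving (quasiMeasurePreserving_const_smul hc.ne'), ?_⟩
  rw [eLpNorm_comp_const_smul hc]
  exact ENNReal.mul_lt_top
    (ENNReal.rpow_lt_top_of_nonneg ENNReal.toReal_nonneg ENNReal.ofReal_ne_top) hg.2

lemma bochnerNorm_comp_const_smul_le {A : Type*} [NormedAddCommGroup A] [NormedSpace ℂ A]
    {ι : A →L[ℂ] S} {c : ℝ} (hc : 0 < c) (r : ℝ≥0∞) (h : EuclideanSpace ℝ (Fin d) → S) :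
    bochnerNorm volume ι r (fun x => h (c • x)) ≤
      ENNReal.ofReal (c ^ d)⁻¹ ^ (1 / r).toReal * bochnerNorm volume ι r h := by
  have h0 : ENNReal.ofReal (c ^ d)⁻¹ ^ (1 / r).toReal ≠ 0 := by
    simp [ENNReal.rpow_eq_zero_iff, pow_pos hc d]
  have htop : ENNReal.ofReal (c ^ d)⁻¹ ^ (1 / r).toReal ≠ ∞ :=
    ENNReal.rpow_ne_top_of_nonneg ENNReal.toReal_nonneg ENNReal.ofReal_ne_top
  rw [bochnerNorm.eq_def volume ι r h]
  simp only [ENNReal.mul_iInf_of_ne h0 htop]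
  refine le_iInf fun g => le_iInf fun hg => le_iInf fun hgh => ?_
  exact (bochnerNorm_le (memLp_comp_const_smul hc hg)
    ((quasiMeasurePreserving_const_smul hc.ne').ae_eq_comp hgh)).trans_eq
      (eLpNorm_comp_const_smul hc g r)

/-- The Jacobian c^d from the forward transform cancels that of the inverse one. -/
lemma contMultiplierOp_comp_const_smul {c : ℝ} (hc : 0 < c)
    (m : EuclideanSpace ℝ (Fin d) → (B →L[ℂ] S)) (F : EuclideanSpace ℝ (Fin d) → B)
    (z : EuclideanSpace ℝ (Fin d)) :
    contMultiplierOp (fun ξ => m (c⁻¹ • ξ)) F z =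
      contMultiplierOp m (fun x => F (c⁻¹ • x)) (c • z) := by
  have hF : ∀ ξ, 𝓕 (fun x => F (c⁻¹ • x)) ξ = (c ^ d) • 𝓕 F (c • ξ) := by
    intro ξ
    rw [Real.fourier_eq, Real.fourier_eq]
    have h := Measure.integral_comp_smul volume
      (fun y => Real.fourierChar (-inner ℝ y (c • ξ)) • F y) c⁻¹
    simp only [inner_smul_left, inner_smul_right, finrank_euclideanSpace, Fintype.card_fin] at h
    rw [abs_of_pos (by positivity), inv_pow, inv_inv] at h
    simpa [hc.ne', inner_smul_right] using h
  rw [contMultiplierOp, contMultiplierOp, Real.fourierInv_eq, Real.fourierInv_eq]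
  simp only [hF]
  have h := Measure.integral_comp_smul volume
      (fun η => Real.fourierChar (inner ℝ η z) • m (c⁻¹ • η) (𝓕 F η)) c
  simp only [finrank_euclideanSpace, Fintype.card_fin, inv_smul_smul₀ hc.ne'] at h
  rw [abs_of_pos (by positivity), eq_comm, inv_smul_eq_iff₀ (pow_pos hc d).ne'] at h
  rw [h, ← integral_smul]
  refine integral_congr_ae (.of_forall fun ξ => ?_)
  simp only [inner_smul_left, inner_smul_right]
  rw [← Complex.coe_smul, ← Complex.coe_smul, map_smul, smul_comm]
  rfl

/-- With D = c^{-d}, dilating the output fixes L^∞ and multiplies the L^{θp} norm by E = D^{1/(θp)},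
which amounts to replacing t by tE. The gain E^θ = D^{1/p} cancels the factor D^{-1/p} from dilating
F. As E is an arbitrary positive number, the bound is needed at all t, not only at powers of 2. -/
lemma KBound.dilate {P : CompatiblePair A₀ A₁ S} {p θ : ℝ} {N : ℝ≥0∞} (hp : 0 < p) (hθ : 0 < θ)
    {m : EuclideanSpace ℝ (Fin d) → (B →L[ℂ] S)} (hN : KBound P p θ N m) {c : ℝ} (hc : 0 < c) :
    KBound P p θ N (fun ξ => m (c⁻¹ • ξ)) := by
  intro F hF1 hFp t ht0 ht
  set D : ℝ≥0∞ := ENNReal.ofReal (c ^ d)⁻¹ with hD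
  have hD0 : D ≠ 0 := by simpa [hD] using pow_pos hc d
  have hDtop : D ≠ ∞ := ENNReal.ofReal_ne_top
  have hr : (1 / ENNReal.ofReal (θ * p)).toReal = 1 / (θ * p) := by
    rw [ENNReal.toReal_div, ENNReal.toReal_one, ENNReal.toReal_ofReal (by positivity)]
  have hp' : (1 / ENNReal.ofReal p).toReal = 1 / p := by
    rw [ENNReal.toReal_div, ENNReal.toReal_one, ENNReal.toReal_ofReal hp.le]
  set F' : EuclideanSpace ℝ (Fin d) → B := fun x => F (c⁻¹ • x) with hF'
  have hc' : 0 < c⁻¹ := inv_pos.2 hc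
  have hFF' : eLpNorm F' (ENNReal.ofReal p) volume =
      D ^ (-(1 / p)) * eLpNorm F (ENNReal.ofReal p) volume := by
    rw [hF', eLpNorm_comp_const_smul hc', hp', inv_pow, inv_inv, ENNReal.rpow_neg,
      ← ENNReal.inv_rpow, hD, ← ENNReal.ofReal_inv_of_pos (by positivity), inv_inv]
  set E := D ^ (1 / (θ * p)) with hE
  have hE0 : E ≠ 0 := by simp [hE, ENNReal.rpow_eq_zero_iff, hD0, hDtop]
  have hEtop : E ≠ ∞ := ENNReal.rpow_ne_top_of_nonneg (by positivity) hDtop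
  have key := hN F' (memLp_comp_const_smul hc' hF1) (memLp_comp_const_smul hc' hFp) (t * E)
    (mul_ne_zero ht0 hE0) (ENNReal.mul_ne_top ht hEtop)
  calc _ ≤ peetreK (bochnerNorm volume P.ι₀ ∞)
        (bochnerNorm volume P.ι₁ (ENNReal.ofReal (θ * p))) (t * E) (contMultiplierOp m F') := by
        refine le_iInf fun a₀ => le_iInf fun a₁ => le_iInf fun hadd => ?_
        refine (peetreK_le (a₀ := fun x => a₀ (c • x)) (a₁ := fun x => a₁ (c • x)) ?_).trans ?_
        · ext z
          rw [contMultiplierOp_comp_const_smul hc, ← hF', ← hadd]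
          rfl
        · have h0 := bochnerNorm_comp_const_smul_le (ι := P.ι₀) hc ∞ a₀
          have h1 := bochnerNorm_comp_const_smul_le (ι := P.ι₁) hc (ENNReal.ofReal (θ * p)) a₁
          rw [hr] at h1
          simp only [ENNReal.div_top, ENNReal.toReal_zero, ENNReal.rpow_zero, one_mul] at h0
          rw [mul_assoc]
          gcongr
    _ ≤ _ := key
    _ = _ := by
      rw [hFF', ENNReal.mul_rpow_of_nonneg _ _ hθ.le, hE, ← ENNReal.rpow_mul]
      have : D ^ (1 / (θ * p) * θ) * D ^ (-(1 / p)) = 1 := by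
        rw [← ENNReal.rpow_add _ _ hD0 hDtop]
        convert ENNReal.rpow_zero using 2
        field_simp
        ring
      calc _ = N * t ^ θ * (D ^ (1 / (θ * p) * θ) * D ^ (-(1 / p))) *
            eLpNorm F (ENNReal.ofReal p) volume := by ring
        _ = _ := by rw [this, mul_one]

/-- Bounds for the norm of `[L^∞(A₀), L^{θp}(A₁)]_{θ,∞}` control the `K`-functional at all
scales. -/
lemma kBound_of_forall_bochnerInterpNorm_le {P : CompatiblePair A₀ A₁ S} {p θ : ℝ} {N : ℝ≥0∞}
    (hθ : 0 < θ) {m : EuclideanSpace ℝ (Fin d) → (B →L[ℂ] S)}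
    (hN : ∀ F : EuclideanSpace ℝ (Fin d) → B, MemLp F 1 volume →
      MemLp F (ENNReal.ofReal p) volume →
      bochnerInterpNorm volume P (ENNReal.ofReal (θ * p)) θ (contMultiplierOp m F) ≤
        N * eLpNorm F (ENNReal.ofReal p) volume) :
    KBound P p θ (2 ^ θ * N) m := by
  intro F hF1 hFp t ht0 ht
  -- Since 2^j ≤ t < 2^{j+1} and K increases in t, level j + 1 is used; 2^{(j+1)θ} ≤ (2t)^θ accounts
  -- for the factor 2^θ.
  obtain ⟨j, hj, hj'⟩ := ENNReal.exists_mem_Ico_zpow ht0 ht (y := 2) (by norm_num) (by norm_num)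
  have h := (le_iSup _ (j + 1)).trans (hN F hF1 hFp)
  set a : ℝ := -((j + 1 : ℤ) : ℝ) * θ with ha
  have h2 : (2 : ℝ≥0∞) ^ (-a) * 2 ^ a = 1 := by
    rw [← ENNReal.rpow_add _ _ (by norm_num) (by norm_num), neg_add_cancel, ENNReal.rpow_zero]
  have h3 : (2 : ℝ≥0∞) ^ (-a) ≤ 2 ^ θ * t ^ θ := by
    rw [← ENNReal.mul_rpow_of_nonneg _ _ hθ.le, ha, ← neg_mul, neg_neg, ENNReal.rpow_mul,
      ENNReal.rpow_intCast, ENNReal.zpow_add (by norm_num) (by norm_num), zpow_one, mul_comm 2 t]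
    gcongr
  have hmono : ∀ (N₀ N₁ : (EuclideanSpace ℝ (Fin d) → S) → ℝ≥0∞) x,
      peetreK N₀ N₁ t x ≤ peetreK N₀ N₁ (2 ^ (j + 1)) x := fun N₀ N₁ x => by
    unfold peetreK
    gcongr
  calc _ ≤ _ := hmono _ _ _
    _ = 2 ^ (-a) * (2 ^ a * peetreK (bochnerNorm volume P.ι₀ ∞)
        (bochnerNorm volume P.ι₁ (ENNReal.ofReal (θ * p))) (2 ^ (j + 1))
        (contMultiplierOp m F)) := by rw [← mul_assoc, h2, one_mul]
    _ ≤ 2 ^ θ * t ^ θ * (N * eLpNorm F (ENNReal.ofReal p) volume) := by gcongr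
    _ = _ := by ring

end Dilation

/-! ### Gluing the residue classes -/

section Gluing

variable {d q : ℕ} {A₀ A₁ B S : Type*} [NormedAddCommGroup A₀] [NormedSpace ℂ A₀]
  [NormedAddCommGroup A₁] [NormedSpace ℂ A₁] [NormedAddCommGroup B]
  [NormedAddCommGroup S] [NormedSpace ℂ S]

lemma tsum_eq_sum_tsum_residue [NeZero q] (w : (Fin d → ℤ) → ℝ≥0∞) :
    ∑' l, w l = ∑ s : Fin d → Fin q, ∑' k, w ((q : ℤ) • k + latticeResidue s) := by
  rw [← (latticeDivMod d q).symm.tsum_eq w, ← (Equiv.prodComm _ _).tsum_eq,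
    ENNReal.tsum_prod', tsum_fintype]
  simp only [Equiv.prodComm_apply, Prod.swap_prod_mk, latticeDivMod_symm_apply]

lemma eLpNorm_count_rpow {X F : Type*} [MeasurableSpace X] [MeasurableSingletonClass X]
    [NormedAddCommGroup F] (g : X → F) {r : ℝ} (hr : 0 < r) :
    eLpNorm g (ENNReal.ofReal r) Measure.count ^ r = ∑' x, ‖g x‖ₑ ^ r := by
  rw [eLpNorm_eq_lintegral_rpow_enorm_toReal (by simpa using hr) ENNReal.ofReal_ne_top,
    ENNReal.toReal_ofReal hr.le, ← ENNReal.rpow_mul, one_div_mul_cancel hr.ne', ENNReal.rpow_one,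
    lintegral_count]

/-- If the parts of an operator on the residue classes modulo `q` are bounded, so is the
operator. -/
lemma peetreK_le_of_residue [NeZero q] {P : CompatiblePair A₀ A₁ S} {p θ : ℝ} {N : ℝ≥0∞}
    (hp : 0 < p) (hθ : 0 < θ) (hNtop : N ≠ ∞) {f : (Fin d → ℤ) → B}
    (hfp : MemLp f (ENNReal.ofReal p) Measure.count) {h : (Fin d → ℤ) → S}
    (hdec : ∀ (s : Fin d → Fin q) (t : ℝ≥0∞), t ≠ 0 → t ≠ ∞ →
      ∃ (g₀ : (Fin d → ℤ) → A₀) (g₁ : (Fin d → ℤ) → A₁),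
      (∀ n, P.ι₀ (g₀ n) + P.ι₁ (g₁ n) = h ((q : ℤ) • n + latticeResidue s)) ∧
      (∀ n, ‖g₀ n‖ₑ ≤ N * t ^ θ *
        eLpNorm (fun k => f ((q : ℤ) • k + latticeResidue s)) (ENNReal.ofReal p) Measure.count) ∧
      t * eLpNorm g₁ (ENNReal.ofReal (θ * p)) Measure.count ≤ N * t ^ θ *
        eLpNorm (fun k => f ((q : ℤ) • k + latticeResidue s)) (ENNReal.ofReal p) Measure.count)
    {t : ℝ≥0∞} (ht0 : t ≠ 0) (ht : t ≠ ∞) :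
    peetreK (bochnerNorm Measure.count P.ι₀ ∞)
      (bochnerNorm Measure.count P.ι₁ (ENNReal.ofReal (θ * p))) t h ≤
      2 * (N * t ^ θ * eLpNorm f (ENNReal.ofReal p) Measure.count) := by
  set a := eLpNorm f (ENNReal.ofReal p) Measure.count with ha
  set b : (Fin d → Fin q) → ℝ≥0∞ := fun s =>
    eLpNorm (fun k => f ((q : ℤ) • k + latticeResidue s)) (ENNReal.ofReal p) Measure.count with hb
  have hsum : a ^ p = ∑ s, b s ^ p := by
    simp only [ha, hb, eLpNorm_count_rpow _ hp]
    exact tsum_eq_sum_tsum_residue _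
  have hatop : a ≠ ∞ := hfp.2.ne
  have hba : ∀ s, b s ≤ a := fun s => by
    rw [← ENNReal.rpow_le_rpow_iff hp, hsum]
    exact Finset.single_le_sum (f := fun s => b s ^ p) (fun _ _ => zero_le) (Finset.mem_univ s)
  have hbtop : ∀ s, b s ≠ ∞ := fun s => ((hba s).trans_lt hatop.lt_top).ne
  set Λ := N * t ^ θ * a with hΛ
  have hΛtop : Λ ≠ ∞ := ENNReal.mul_ne_top
    (ENNReal.mul_ne_top hNtop (ENNReal.rpow_ne_top_of_nonneg hθ.le ht)) hatop
  have hclass : ∀ s : Fin d → Fin q, ∃ (g₀ : (Fin d → ℤ) → A₀) (g₁ : (Fin d → ℤ) → A₁),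
      (∀ n, P.ι₀ (g₀ n) + P.ι₁ (g₁ n) = h ((q : ℤ) • n + latticeResidue s)) ∧
      (∀ n, ‖g₀ n‖ₑ ≤ Λ) ∧
      eLpNorm g₁ (ENNReal.ofReal (θ * p)) Measure.count ≤ Λ / t * (b s / a) ^ (1 / θ) := by
    intro s
    -- Here the rescaled level would be infinite, but both bounds vanish at level t already.
    by_cases hs : b s = 0
    · obtain ⟨g₀, g₁, h1, h2, h3⟩ := hdec s t ht0 ht
      refine ⟨g₀, g₁, h1, fun n => (h2 n).trans ?_, ?_⟩
      · change N * t ^ θ * b s ≤ _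
        simp [hs]
      · change _ ≤ N * t ^ θ * b s at h3
        rw [hs, mul_zero, nonpos_iff_eq_zero, mul_eq_zero, or_iff_right ht0] at h3
        simp [h3]
    · have ha0 : a ≠ 0 := fun h0 => hs (by simpa [h0] using hba s)
      -- Chosen so that (tρ)^θ b_s = t^θ a: the L^∞ bound becomes the same for every class.
      set ρ := (a / b s) ^ (1 / θ) with hρ
      have hab0 : a / b s ≠ 0 := by simp [ENNReal.div_eq_zero_iff, ha0, hbtop s]
      have habtop : a / b s ≠ ∞ := ENNReal.div_ne_top hatop hs
      have hρ0 : ρ ≠ 0 := by simp [hρ, ENNReal.rpow_eq_zero_iff, hab0, habtop]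
      have hρtop : ρ ≠ ∞ := ENNReal.rpow_ne_top_of_nonneg (by positivity) habtop
      have hρθ : ρ ^ θ = a / b s := by
        rw [hρ, ← ENNReal.rpow_mul, one_div_mul_cancel hθ.ne', ENNReal.rpow_one]
      have hΛs : N * (t * ρ) ^ θ * b s = Λ := by
        rw [ENNReal.mul_rpow_of_nonneg _ _ hθ.le, hρθ, mul_assoc, mul_assoc,
          ENNReal.div_mul_cancel hs (hbtop s), ← mul_assoc]
      have hinv : (b s / a) ^ (1 / θ) = ρ⁻¹ := by
        rw [hρ, ← ENNReal.inv_rpow, ENNReal.inv_div (Or.inl (hbtop s)) (Or.inl hs)]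
      obtain ⟨g₀, g₁, h1, h2, h3⟩ := hdec s (t * ρ) (mul_ne_zero ht0 hρ0)
        (ENNReal.mul_ne_top ht hρtop)
      refine ⟨g₀, g₁, h1, fun n => (h2 n).trans_eq hΛs, ?_⟩
      have h4 := h3.trans_eq hΛs
      rw [hinv, div_eq_mul_inv, mul_assoc, ← ENNReal.mul_inv (Or.inl ht0) (Or.inl ht),
        ← div_eq_mul_inv, ENNReal.le_div_iff_mul_le (Or.inl (mul_ne_zero ht0 hρ0))
          (Or.inl (ENNReal.mul_ne_top ht hρtop)), mul_comm]
      exact h4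
  choose g₀ g₁ hadd hg₀ hg₁ using hclass
  let e := latticeDivMod d q
  let G₀ : (Fin d → ℤ) → A₀ := fun l => g₀ (e l).2 (e l).1
  let G₁ : (Fin d → ℤ) → A₁ := fun l => g₁ (e l).2 (e l).1
  have he : ∀ k s, e ((q : ℤ) • k + latticeResidue s) = (k, s) := fun k s => by
    rw [← latticeDivMod_symm_apply]; exact e.apply_symm_apply _
  have hr : 0 < θ * p := by positivity
  have hG₀ : eLpNorm G₀ ∞ Measure.count ≤ Λ := by
    rw [eLpNorm_exponent_top]
    exact eLpNormEssSup_le_of_ae_enorm_bound (.of_forall fun l => hg₀ _ _)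
  have hG₁ : eLpNorm G₁ (ENNReal.ofReal (θ * p)) Measure.count ≤ Λ / t := by
    rw [← ENNReal.rpow_le_rpow_iff hr, eLpNorm_count_rpow _ hr, tsum_eq_sum_tsum_residue (q := q)]
    calc ∑ s : Fin d → Fin q, ∑' k, ‖G₁ ((q : ℤ) • k + latticeResidue s)‖ₑ ^ (θ * p)
        = ∑ s, eLpNorm (g₁ s) (ENNReal.ofReal (θ * p)) Measure.count ^ (θ * p) := by
          refine Finset.sum_congr rfl fun s _ => ?_
          rw [eLpNorm_count_rpow _ hr]
          simp only [G₁, he]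
      _ ≤ ∑ s, (Λ / t) ^ (θ * p) * (b s ^ p / a ^ p) := by
          refine Finset.sum_le_sum fun s _ => ?_
          refine (ENNReal.rpow_le_rpow (hg₁ s) hr.le).trans_eq ?_
          rw [ENNReal.mul_rpow_of_nonneg _ _ hr.le, ← ENNReal.rpow_mul,
            ← ENNReal.div_rpow_of_nonneg _ _ hp.le]
          congr 2
          field_simp
      _ = (Λ / t) ^ (θ * p) * (a ^ p / a ^ p) := by
          rw [← Finset.mul_sum, hsum]
          simp only [div_eq_mul_inv, Finset.sum_mul]
      -- Only an inequality, because the quotient is 0 when a = 0.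
      _ ≤ (Λ / t) ^ (θ * p) := mul_le_of_le_one_right zero_le ENNReal.div_self_le_one
  have hm₀ : MemLp G₀ ∞ Measure.count :=
    ⟨(StronglyMeasurable.of_discrete).aestronglyMeasurable, hG₀.trans_lt hΛtop.lt_top⟩
  have hm₁ : MemLp G₁ (ENNReal.ofReal (θ * p)) Measure.count :=
    ⟨(StronglyMeasurable.of_discrete).aestronglyMeasurable,
      hG₁.trans_lt (ENNReal.div_lt_top hΛtop ht0)⟩
  calc _ ≤ bochnerNorm Measure.count P.ι₀ ∞ (fun l => P.ι₀ (G₀ l)) +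
        t * bochnerNorm Measure.count P.ι₁ (ENNReal.ofReal (θ * p)) (fun l => P.ι₁ (G₁ l)) := by
        refine peetreK_le (funext fun l => ?_)
        have h1 := hadd (e l).2 (e l).1
        rw [← latticeDivMod_symm_apply] at h1
        exact h1.trans (congrArg h (e.symm_apply_apply l))
    _ ≤ Λ + t * (Λ / t) := by
        gcongr
        · exact (bochnerNorm_le hm₀ .rfl).trans hG₀
        · exact (bochnerNorm_le hm₁ .rfl).trans hG₁
    _ = 2 * Λ := by rw [ENNReal.mul_div_cancel ht0 ht, two_mul]

lemma memLp_residue [NeZero q] {p : ℝ} (hp : 0 < p) {f : (Fin d → ℤ) → B}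
    (hf : MemLp f (ENNReal.ofReal p) Measure.count) (s : Fin d → Fin q) :
    MemLp (fun k => f ((q : ℤ) • k + latticeResidue s)) (ENNReal.ofReal p) Measure.count := by
  refine ⟨(StronglyMeasurable.of_discrete).aestronglyMeasurable, ?_⟩
  have h : eLpNorm (fun k => f ((q : ℤ) • k + latticeResidue s)) (ENNReal.ofReal p)
      Measure.count ≤ eLpNorm f (ENNReal.ofReal p) Measure.count := by
    rw [← ENNReal.rpow_le_rpow_iff hp, eLpNorm_count_rpow _ hp, eLpNorm_count_rpow _ hp,
      tsum_eq_sum_tsum_residue (q := q) fun l => ‖f l‖ₑ ^ p]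
    exact Finset.single_le_sum
      (f := fun s => ∑' k, ‖f ((q : ℤ) • k + latticeResidue s)‖ₑ ^ p)
      (fun _ _ => zero_le) (Finset.mem_univ s)
  exact h.trans_lt hf.2

end Gluing

end

/-! ### The transference theorem. -/

theorem mainTheorem8 (d : ℕ) (hd : 1 ≤ d) (p θ : ℝ) (hp : 1 < p)
    (hθ₀ : 0 < θ) (hθ₁ : θ < 1) (hpθ : 1 ≤ p * θ) :
    ∃ C : ℝ≥0, 0 < C ∧
      ∀ (q : ℕ), 0 < q →
      ∀ (A₀ : Type*) [NormedAddCommGroup A₀] [NormedSpace ℂ A₀] [FiniteDimensional ℂ A₀]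
        (A₁ : Type*) [NormedAddCommGroup A₁] [NormedSpace ℂ A₁] [FiniteDimensional ℂ A₁]
        (B : Type*) [NormedAddCommGroup B] [NormedSpace ℂ B] [FiniteDimensional ℂ B]
        (S : Type*) [NormedAddCommGroup S] [NormedSpace ℂ S]
        (P : CompatiblePair A₀ A₁ S)
        (m : EuclideanSpace ℝ (Fin d) → (B →L[ℂ] S)),
        AEStronglyMeasurable m volume →
        (∃ M : ℝ, ∀ ξ, ‖m ξ‖ ≤ M) →
        (∀ ξ, ξ ∉ cube d q → m ξ = 0) →
        lpOpNorm (Measure.count : Measure (Fin d → ℤ)) (ENNReal.ofReal p)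
            (bochnerInterpNorm Measure.count P (ENNReal.ofReal (θ * p)) θ)
            (latticeMultiplierOp (periodization q m)) ≤
          C * lpOpNorm (volume : Measure (EuclideanSpace ℝ (Fin d))) (ENNReal.ofReal p)
            (bochnerInterpNorm volume P (ENNReal.ofReal (θ * p)) θ)
            (contMultiplierOp m) := by
  obtain ⟨ψ, M, hψ⟩ := exists_isSamplingKernel d
  have hp0 : 0 < p := by linarith
  -- 2 from adding the two glued pieces, (M + 1)^2 from synthesis and sampling, 2^θ from passing
  -- from dyadic to all t.
  refine ⟨2 * (M + 1) ^ 2 * 2 ^ θ, by positivity, ?_⟩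
  intro q hq A₀ _ _ _ A₁ _ _ _ B _ _ _ S _ _ P m hm ⟨Mb, hMb⟩ hm0
  have : NeZero q := ⟨hq.ne'⟩
  have : CompleteSpace B := FiniteDimensional.complete ℂ B
  have : FiniteDimensional ℂ S := P.finiteDimensional
  have : CompleteSpace S := FiniteDimensional.complete ℂ S
  have hq0 : (0 : ℝ) < q := by exact_mod_cast hq
  have hC0 : ((2 * (M + 1) ^ 2 * 2 ^ θ : ℝ≥0) : ℝ≥0∞) ≠ 0 := by
    rw [ENNReal.coe_ne_zero]; positivity
  -- Any N strictly above the operator norm is an admissible constant and is nonzero, as extracting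
  -- decompositions requires.
  refine ENNReal.le_mul_of_forall_lt (Or.inl hC0) (Or.inl ENNReal.coe_ne_top) ?_
  intro C' hC' N hN
  refine le_trans ?_ (mul_le_mul_left hC'.le N)
  have hN0 : N ≠ 0 := (bot_le.trans_lt hN).ne'
  rcases eq_or_ne N ∞ with rfl | hNtop
  · rw [ENNReal.mul_top hC0]; exact le_top
  obtain ⟨N', hN', hN'N⟩ := sInf_lt_iff.1 hN
  have hK : KBound P p θ (2 ^ θ * N) m := kBound_of_forall_bochnerInterpNorm_le hθ₀
    fun F h1 h2 => (hN' F h1 h2).trans (by gcongr)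
  have h2θ : (2 : ℝ≥0∞) ^ θ ≠ ∞ := ENNReal.rpow_ne_top_of_nonneg hθ₀.le (by norm_num)
  have h2θ0 : (2 : ℝ≥0∞) ^ θ ≠ 0 := by simp [ENNReal.rpow_eq_zero_iff]
  have hKq := hK.dilate hp0 hθ₀ hq0
  refine sInf_le fun f hf1 hfp => ?_
  have hf : Summable fun k => ‖f k‖ :=
    integrable_count_iff.1 (memLp_one_iff_integrable.1 hf1)
  have hdec := fun (s : Fin d → Fin q) (t : ℝ≥0∞) (ht0 : t ≠ 0) (ht : t ≠ ∞) =>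
    hKq.exists_decomposition (mul_ne_zero h2θ0 hN0) (ENNReal.mul_ne_top h2θ hNtop) hp.le
      (by rwa [mul_comm] at hpθ) hθ₀.le
      (hm.comp_quasiMeasurePreserving (quasiMeasurePreserving_const_smul (inv_pos.2 hq0).ne'))
      -- Dilation by q carries the cube of side 1/q onto the unit cube, where ψ reproduces.
      (fun ξ => hMb _) (fun ξ hξ => hm0 _ fun h => hξ fun i => by
        have := h i
        rw [PiLp.smul_apply, smul_eq_mul, abs_mul, abs_of_pos (inv_pos.2 hq0),
          inv_mul_le_iff₀ hq0, mul_div_cancel₀ _ hq0.ne'] at this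
        simpa using this)
      hψ (f := fun k => f ((q : ℤ) • k + latticeResidue s))
      (by
        have h1 := memLp_residue one_pos (by simpa using hf1) s
        rw [ENNReal.ofReal_one] at h1
        exact integrable_count_iff.1 (memLp_one_iff_integrable.1 h1))
      (memLp_residue hp0 hfp s) ht0 ht
  refine iSup_le fun j => ?_
  have ht0 : (2 : ℝ≥0∞) ^ j ≠ 0 := (ENNReal.zpow_pos (by norm_num) (by norm_num) j).ne'
  have ht : (2 : ℝ≥0∞) ^ j ≠ ∞ := (ENNReal.zpow_lt_top (by norm_num) (by norm_num) j).ne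
  have key := peetreK_le_of_residue (P := P) (N := (M + 1) ^ 2 * (2 ^ θ * N)) hp0 hθ₀
    (ENNReal.mul_ne_top (by finiteness) (ENNReal.mul_ne_top h2θ hNtop)) hfp
    (h := latticeMultiplierOp (periodization q m) f) (q := q)
    (fun s t ht0 ht => by
      simpa only [latticeMultiplierOp_periodization hq hm hMb hm0 hf, mul_assoc]
        using hdec s t ht0 ht) ht0 ht
  have hj : (2 : ℝ≥0∞) ^ (-(j : ℝ) * θ) * ((2 : ℝ≥0∞) ^ j) ^ θ = 1 := by
    rw [← ENNReal.rpow_intCast, ← ENNReal.rpow_mul,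
      ← ENNReal.rpow_add _ _ (by norm_num) (by norm_num), neg_mul, neg_add_cancel,
      ENNReal.rpow_zero]
  calc _ ≤ (2 : ℝ≥0∞) ^ (-(j : ℝ) * θ) * (2 * ((M + 1) ^ 2 * (2 ^ θ * N) * (2 ^ j) ^ θ *
        eLpNorm f (ENNReal.ofReal p) Measure.count)) := mul_le_mul_right key _
    _ = ((2 : ℝ≥0∞) ^ (-(j : ℝ) * θ) * ((2 : ℝ≥0∞) ^ j) ^ θ) * (2 * (M + 1) ^ 2 * 2 ^ θ * N *
        eLpNorm f (ENNReal.ofReal p) Measure.count) := by ring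
    _ = _ := by
      rw [hj, one_mul]
      push_cast
      rw [ENNReal.coe_rpow_of_nonneg _ hθ₀.le]
      rfl
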